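/- Let $\mathbb{K}$ be a field of characteristic zero and let $\mathcal{A}=\mathbb{K}[X_1,\ldots,X_6]$ be the semiclassical limit of $U_q^+(G_2)$, that is, the polynomial algebra endowed with the Poisson bracket determined by \begin{align*} \{X_2, X_1\}&=-3X_1X_2, & \{X_3,X_1\}&=-X_1X_3-X_2, & \{X_3,X_2\}&=-3X_2X_3,\\ \{X_4, X_1\}&=-2X_3^2, & \{X_4, X_2\}&=-3X_2X_4-4X_3^3, & \{X_4, X_3\}&=-3X_3X_4,\\ \{X_5, X_1\}&=X_1X_5-2X_3, & \{X_5,X_2\}&=-6X_3^2, & \{X_5,X_3\}&=-X_3X_5-3X_4,\\ \{X_5,X_4\}&=-3X_4X_5, & \{X_6,X_1\}&=3X_1X_6-3X_5, & \{X_6, X_2\}&=3X_2X_6+9X_4-18X_3X_5,\\ \{X_6, X_3\}&=-6X_5^2, & \{X_6, X_4\}&=-3X_4X_6-4X_5^3, & \{X_6, X_5\}&=-3X_5X_6. \end{align*} Put $$\Omega_1=X_1X_3X_5-\tfrac32X_1X_4-\tfrac12X_2X_5+\tfrac12X_3^2,$$ $$\Omega_2=X_2X_4X_6-\tfrac23X_3^3X_6-\tfrac23X_2X_5^3+2X_3^2X_5^2-3X_3X_4X_5+\tfrac32X_4^2,$$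 which are Poisson central in $\mathcal{A}$. A Poisson ideal of a Poisson algebra $B$ is an ideal $I$ with $\{B,I\}\subseteq I$. A proper Poisson ideal $P$ is Poisson prime if $I_1I_2\subseteq P$ implies $I_1\subseteq P$ or $I_2\subseteq P$ for all Poisson ideals $I_1,I_2$; it is a maximal Poisson ideal if no proper Poisson ideal strictly contains it. $B$ is Poisson-simple if $B\neq0$ and its only Poisson ideals are $0$ and $B$. For every $(\alpha,\beta)\in\mathbb{K}^2\setminus\{(0,0)\}$, the ideal $\langle\Omega_1-\alpha,\Omega_2-\beta\rangle$ of $\mathcal{A}$ is a Poisson prime ideal and a maximal Poisson ideal. Hence the quotient $\mathcal{A}_{\alpha,\beta}=\mathcal{A}/\langle\Omega_1-\alpha,\Omega_2-\beta\rangle$, with the induced Poisson bracket, is a Poisson-simple noetherian domain. -/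

import Mathlib

open MvPolynomial

/-- A Poisson bracket on a commutative `K`-algebra `A`: a skew-symmetric `K`-bilinear map
satisfying the Leibniz rule and the Jacobi identity. -/
structure PoissonBracket (K A : Type*) [CommRing K] [CommRing A] [Algebra K A] where
  /-- The underlying bilinear map `(x, y) ↦ {x, y}`. -/
  bracket : A →ₗ[K] A →ₗ[K] A
  skew : ∀ x y, bracket x y = -bracket y x
  leibniz : ∀ x y z, bracket x (y * z) = bracket x y * z + y * bracket x z
  jacobi : ∀ x y z,
    bracket x (bracket y z) + bracket y (bracket z x) + bracket z (bracket x y) = 0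

namespace PoissonBracket

variable {K A : Type*} [CommRing K] [CommRing A] [Algebra K A]

/-- A Poisson ideal is an ideal `I` with `{A, I} ⊆ I`. -/
def IsPoissonIdeal (P : PoissonBracket K A) (I : Ideal A) : Prop :=
  ∀ x, ∀ y ∈ I, P.bracket x y ∈ I

/-- A Poisson prime ideal is a proper Poisson ideal `I` such that, for all Poisson ideals
`I₁`, `I₂` with `I₁ I₂ ⊆ I`, one has `I₁ ⊆ I` or `I₂ ⊆ I`. -/
def IsPoissonPrime (P : PoissonBracket K A) (I : Ideal A) : Prop :=
  P.IsPoissonIdeal I ∧ I ≠ ⊤ ∧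
    ∀ I₁ I₂ : Ideal A, P.IsPoissonIdeal I₁ → P.IsPoissonIdeal I₂ →
      I₁ * I₂ ≤ I → I₁ ≤ I ∨ I₂ ≤ I

/-- A maximal Poisson ideal is a proper Poisson ideal which is not strictly contained in any
other proper Poisson ideal. -/
def IsMaximalPoissonIdeal (P : PoissonBracket K A) (I : Ideal A) : Prop :=
  P.IsPoissonIdeal I ∧ I ≠ ⊤ ∧
    ∀ J : Ideal A, P.IsPoissonIdeal J → I ≤ J → J ≠ ⊤ → J = I

/-- A Poisson algebra is Poisson-simple if it is non-zero and its only Poisson ideals are `0`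
and the whole algebra. -/
def IsPoissonSimple (P : PoissonBracket K A) : Prop :=
  Nontrivial A ∧ ∀ I : Ideal A, P.IsPoissonIdeal I → I = ⊥ ∨ I = ⊤

theorem IsPoissonIdeal.left {P : PoissonBracket K A} {I : Ideal A} (hI : P.IsPoissonIdeal I)
    {x : A} (hx : x ∈ I) (y : A) : P.bracket x y ∈ I := by
  rw [P.skew]
  exact I.neg_mem (hI y x hx)

/-- The induced Poisson bracket `{x + I, y + I} = {x, y} + I` on the quotient by a Poisson
ideal. -/
def quotient (P : PoissonBracket K A) (I : Ideal A) (hI : P.IsPoissonIdeal I) :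
    PoissonBracket K (A ⧸ I) where
  bracket :=
    ((Submodule.restrictScalars K I).liftQ
      (LinearMap.mk₂ K
        (fun x (y : A ⧸ I) =>
          (Submodule.restrictScalars K I).mapQ (Submodule.restrictScalars K I) (P.bracket x)
            (fun y hy => hI x y hy) y)
        (fun x x' y => by
          obtain ⟨y, rfl⟩ := Ideal.Quotient.mk_surjective y
          change Ideal.Quotient.mk I (P.bracket (x + x') y) =
            Ideal.Quotient.mk I (P.bracket x y) + Ideal.Quotient.mk I (P.bracket x' y)
          simp)
        (fun c x y => by
          obtain ⟨y, rfl⟩ := Ideal.Quotient.mk_surjective y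
          change Ideal.Quotient.mk I (P.bracket (c • x) y) =
            c • Ideal.Quotient.mk I (P.bracket x y)
          rw [map_smul]
          rfl)
        (fun x y y' => map_add _ y y')
        (fun c x y => map_smul _ c y))
      (fun x hx => by
        refine LinearMap.mem_ker.2 (LinearMap.ext fun y => ?_)
        obtain ⟨y, rfl⟩ := Ideal.Quotient.mk_surjective y
        exact Ideal.Quotient.eq_zero_iff_mem.2 (hI.left hx y)) :
      (A ⧸ I) →ₗ[K] (A ⧸ I) →ₗ[K] (A ⧸ I))
  skew := by
    intro x y
    obtain ⟨x, rfl⟩ := Ideal.Quotient.mk_surjective x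
    obtain ⟨y, rfl⟩ := Ideal.Quotient.mk_surjective y
    exact congrArg (Ideal.Quotient.mk I) (P.skew x y)
  leibniz := by
    intro x y z
    obtain ⟨x, rfl⟩ := Ideal.Quotient.mk_surjective x
    obtain ⟨y, rfl⟩ := Ideal.Quotient.mk_surjective y
    obtain ⟨z, rfl⟩ := Ideal.Quotient.mk_surjective z
    exact congrArg (Ideal.Quotient.mk I) (P.leibniz x y z)
  jacobi := by
    intro x y z
    obtain ⟨x, rfl⟩ := Ideal.Quotient.mk_surjective x
    obtain ⟨y, rfl⟩ := Ideal.Quotient.mk_surjective y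
    obtain ⟨z, rfl⟩ := Ideal.Quotient.mk_surjective z
    exact congrArg (Ideal.Quotient.mk I) (P.jacobi x y z)

theorem quotient_bracket_mk (P : PoissonBracket K A) (I : Ideal A) (hI : P.IsPoissonIdeal I)
    (x y : A) :
    (P.quotient I hI).bracket (Ideal.Quotient.mk I x) (Ideal.Quotient.mk I y) =
      Ideal.Quotient.mk I (P.bracket x y) := rfl

end PoissonBracket

namespace G2

/-! The variable `X i`, `i : Fin 6`, stands for the generator `X_{i+1}`. -/

/-- The brackets `{X_{i+1}, X_{j+1}}` for `i > j` (the entries on and above the diagonal are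
`0`). -/
noncomputable def lower (K : Type*) [Field K] :
    Matrix (Fin 6) (Fin 6) (MvPolynomial (Fin 6) K) :=
  let X₁ : MvPolynomial (Fin 6) K := X 0
  let X₂ : MvPolynomial (Fin 6) K := X 1
  let X₃ : MvPolynomial (Fin 6) K := X 2
  let X₄ : MvPolynomial (Fin 6) K := X 3
  let X₅ : MvPolynomial (Fin 6) K := X 4
  let X₆ : MvPolynomial (Fin 6) K := X 5
  !![0, 0, 0, 0, 0, 0;
     -3 * X₁ * X₂, 0, 0, 0, 0, 0;
     -X₁ * X₃ - X₂, -3 * X₂ * X₃, 0, 0, 0, 0;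
     -2 * X₃ ^ 2, -3 * X₂ * X₄ - 4 * X₃ ^ 3, -3 * X₃ * X₄, 0, 0, 0;
     X₁ * X₅ - 2 * X₃, -6 * X₃ ^ 2, -X₃ * X₅ - 3 * X₄, -3 * X₄ * X₅, 0, 0;
     3 * X₁ * X₆ - 3 * X₅, 3 * X₂ * X₆ + 9 * X₄ - 18 * X₃ * X₅, -6 * X₅ ^ 2,
       -3 * X₄ * X₆ - 4 * X₅ ^ 3, -3 * X₅ * X₆, 0]

/-- The skew-symmetric matrix of the brackets of the generators. -/
noncomputable def gen (K : Type*) [Field K] :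
    Matrix (Fin 6) (Fin 6) (MvPolynomial (Fin 6) K) :=
  lower K - (lower K).transpose

/-- The bilinear map `{f, g} = ∑ i j, {X_i, X_j} (∂f/∂X_i) (∂g/∂X_j)`. -/
noncomputable def bracketMap (K : Type*) [Field K] :
    MvPolynomial (Fin 6) K →ₗ[K] MvPolynomial (Fin 6) K →ₗ[K] MvPolynomial (Fin 6) K :=
  LinearMap.mk₂ K
    (fun f g => ∑ i, ∑ j, gen K i j * pderiv i f * pderiv j g)
    (fun f f' g => by
      simp only [map_add, mul_add, add_mul, Finset.sum_add_distrib])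
    (fun c f g => by
      simp only [Derivation.map_smul, Finset.smul_sum, mul_smul_comm, smul_mul_assoc])
    (fun f g g' => by
      simp only [map_add, mul_add, Finset.sum_add_distrib])
    (fun c f g => by
      simp only [Derivation.map_smul, Finset.smul_sum, mul_smul_comm])

theorem bracketMap_apply (K : Type*) [Field K] (f g : MvPolynomial (Fin 6) K) :
    bracketMap K f g = ∑ i, ∑ j, gen K i j * pderiv i f * pderiv j g := rfl

theorem bracketMap_skew (K : Type*) [Field K] (f g : MvPolynomial (Fin 6) K) :
    bracketMap K f g = -bracketMap K g f := by
  rw [bracketMap_apply, bracketMap_apply, Finset.sum_comm, ← Finset.sum_neg_distrib]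
  refine Finset.sum_congr rfl fun i _ => ?_
  rw [← Finset.sum_neg_distrib]
  refine Finset.sum_congr rfl fun j _ => ?_
  simp only [gen, Matrix.sub_apply, Matrix.transpose_apply]
  ring

theorem bracketMap_leibniz (K : Type*) [Field K] (f g h : MvPolynomial (Fin 6) K) :
    bracketMap K f (g * h) = bracketMap K f g * h + g * bracketMap K f h := by
  simp only [bracketMap_apply, Derivation.leibniz, smul_eq_mul, Finset.sum_mul, Finset.mul_sum,
    ← Finset.sum_add_distrib]
  refine Finset.sum_congr rfl fun i _ => Finset.sum_congr rfl fun j _ => ?_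
  ring

theorem bracketMap_C (K : Type*) [Field K] (f : MvPolynomial (Fin 6) K) (a : K) :
    bracketMap K f (C a) = 0 := by
  simp [bracketMap_apply]

theorem bracketMap_X_X (K : Type*) [Field K] (i j : Fin 6) :
    bracketMap K (X i) (X j) = gen K i j := by
  simp [bracketMap_apply, pderiv_X, Pi.single_apply, Finset.sum_ite_eq]

theorem bracketMap_natCast (K : Type*) [Field K] (f : MvPolynomial (Fin 6) K) (n : ℕ) :
    bracketMap K f (n : MvPolynomial (Fin 6) K) = 0 := by
  have := bracketMap_C K f (n : K)
  rwa [map_natCast] at this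

theorem bracketMap_pow (K : Type*) [Field K] (f g : MvPolynomial (Fin 6) K) (n : ℕ) :
    bracketMap K f (g ^ n) = n * g ^ (n - 1) * bracketMap K f g := by
  simp only [bracketMap_apply, Derivation.leibniz_pow, smul_eq_mul, nsmul_eq_mul, Finset.mul_sum]
  refine Finset.sum_congr rfl fun i _ => Finset.sum_congr rfl fun j _ => ?_
  ring

set_option maxHeartbeats 1000000 in
theorem jacobi_X_of_lt (K : Type*) [Field K] (i j k : Fin 6) (hij : i < j) (hjk : j < k) :
    bracketMap K (X i) (bracketMap K (X j) (X k)) +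
      bracketMap K (X j) (bracketMap K (X k) (X i)) +
      bracketMap K (X k) (bracketMap K (X i) (X j)) = 0 := by
  have n2 (f) : bracketMap K f 2 = 0 := by exact_mod_cast bracketMap_natCast K f 2
  have n3 (f) : bracketMap K f 3 = 0 := by exact_mod_cast bracketMap_natCast K f 3
  have n4 (f) : bracketMap K f 4 = 0 := by exact_mod_cast bracketMap_natCast K f 4
  have n6 (f) : bracketMap K f 6 = 0 := by exact_mod_cast bracketMap_natCast K f 6
  have n9 (f) : bracketMap K f 9 = 0 := by exact_mod_cast bracketMap_natCast K f 9
  have n18 (f) : bracketMap K f 18 = 0 := by exact_mod_cast bracketMap_natCast K f 18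
  simp only [bracketMap_X_X]
  fin_cases i <;> fin_cases j <;> first | (exfalso; revert hij; decide) | skip
  all_goals fin_cases k <;> first | (exfalso; revert hjk; decide) | skip
  all_goals
    simp [gen, lower, bracketMap_leibniz, bracketMap_pow, n2, n3, n4, n6, n9, n18,
      bracketMap_X_X]
    ring

theorem jacobi_X (K : Type*) [Field K] (i j k : Fin 6) :
    bracketMap K (X i) (bracketMap K (X j) (X k)) +
      bracketMap K (X j) (bracketMap K (X k) (X i)) +
      bracketMap K (X k) (bracketMap K (X i) (X j)) = 0 := by
  have hd : ∀ i k : Fin 6, bracketMap K (X i) (bracketMap K (X i) (X k)) +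
      bracketMap K (X i) (bracketMap K (X k) (X i)) +
      bracketMap K (X k) (bracketMap K (X i) (X i)) = 0 := by
    intro i k
    have h0 : bracketMap K (X i) (X i) = 0 := by rw [bracketMap_X_X]; simp [gen]
    rw [h0, bracketMap_skew K (X k) (X i), map_neg, map_zero]
    ring
  have hs : ∀ i j k : Fin 6, bracketMap K (X j) (bracketMap K (X i) (X k)) +
      bracketMap K (X i) (bracketMap K (X k) (X j)) +
      bracketMap K (X k) (bracketMap K (X j) (X i)) =
      -(bracketMap K (X i) (bracketMap K (X j) (X k)) +
      bracketMap K (X j) (bracketMap K (X k) (X i)) +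
      bracketMap K (X k) (bracketMap K (X i) (X j))) := by
    intro i j k
    rw [bracketMap_skew K (X i) (X k), bracketMap_skew K (X k) (X j),
      bracketMap_skew K (X j) (X i), map_neg, map_neg, map_neg]
    ring
  have L := jacobi_X_of_lt K
  rcases lt_trichotomy i j with h1 | rfl | h1
  · rcases lt_trichotomy j k with h2 | rfl | h2
    · exact L i j k h1 h2
    · linear_combination hd j i
    · rcases lt_trichotomy i k with h3 | rfl | h3
      · linear_combination hs i k j - L i k j h3 h2
      · linear_combination hd i j
      · linear_combination L k i j h3 h1
  · exact hd i k
  · rcases lt_trichotomy i k with h2 | rfl | h2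
    · linear_combination hs j i k - L j i k h1 h2
    · linear_combination hd i j
    · rcases lt_trichotomy j k with h3 | rfl | h3
      · linear_combination L j k i h3 h2
      · linear_combination hd j i
      · linear_combination hs k j i - L k j i h3 h1

/-- An element bracketing to zero with all generators is Poisson central. -/
theorem bracketMap_eq_zero (K : Type*) [Field K] {f : MvPolynomial (Fin 6) K}
    (hf : ∀ i, bracketMap K f (X i) = 0) (g : MvPolynomial (Fin 6) K) :
    bracketMap K f g = 0 := by
  induction g using MvPolynomial.induction_on with
  | C a => exact bracketMap_C K f a
  | add p q hp hq => rw [map_add, hp, hq, add_zero]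
  | mul_X p i hp => rw [bracketMap_leibniz, hp, hf, zero_mul, mul_zero, add_zero]

/-- One induction step of the Jacobi identity: it is enough to check it on generators in the
last argument. -/
theorem jacobi_step (K : Type*) [Field K] (f g : MvPolynomial (Fin 6) K)
    (H : ∀ k, bracketMap K f (bracketMap K g (X k)) + bracketMap K g (bracketMap K (X k) f) +
      bracketMap K (X k) (bracketMap K f g) = 0) (h : MvPolynomial (Fin 6) K) :
    bracketMap K f (bracketMap K g h) + bracketMap K g (bracketMap K h f) +
      bracketMap K h (bracketMap K f g) = 0 := by
  have key : ∀ h, bracketMap K f (bracketMap K g h) + bracketMap K g (bracketMap K h f) +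
      bracketMap K h (bracketMap K f g) =
      bracketMap K f (bracketMap K g h) - bracketMap K g (bracketMap K f h) -
      bracketMap K (bracketMap K f g) h := by
    intro h
    rw [bracketMap_skew K h f, bracketMap_skew K h (bracketMap K f g), map_neg]
    ring
  simp only [key] at H ⊢
  induction h using MvPolynomial.induction_on with
  | C a => simp only [bracketMap_C, map_zero, sub_zero]
  | add p q hp hq =>
    simp only [map_add]
    linear_combination hp + hq
  | mul_X p i hp =>
    simp only [bracketMap_leibniz, map_add]
    linear_combination X i * hp + p * H i

theorem bracketMap_jacobi (K : Type*) [Field K] (f g h : MvPolynomial (Fin 6) K) :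
    bracketMap K f (bracketMap K g h) + bracketMap K g (bracketMap K h f) +
      bracketMap K h (bracketMap K f g) = 0 := by
  refine jacobi_step K f g (fun k => ?_) h
  have h1 := jacobi_step K (X k) f (fun j => ?_) g
  · linear_combination h1
  have h2 := jacobi_step K (X j) (X k) (fun i => jacobi_X K j k i) f
  linear_combination h2

/-- The semiclassical limit `𝒜 = K[X₁, …, X₆]` of `U_q⁺(G₂)`: the Poisson bracket on the
polynomial algebra. -/
noncomputable def poisson (K : Type*) [Field K] : PoissonBracket K (MvPolynomial (Fin 6) K) where
  bracket := bracketMap K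
  skew := bracketMap_skew K
  leibniz := bracketMap_leibniz K
  jacobi := bracketMap_jacobi K

/-- `Ω₁ = X₁X₃X₅ - (3/2)X₁X₄ - (1/2)X₂X₅ + (1/2)X₃²`. -/
noncomputable def Omega₁ (K : Type*) [Field K] : MvPolynomial (Fin 6) K :=
  let X₁ : MvPolynomial (Fin 6) K := X 0
  let X₂ : MvPolynomial (Fin 6) K := X 1
  let X₃ : MvPolynomial (Fin 6) K := X 2
  let X₄ : MvPolynomial (Fin 6) K := X 3
  let X₅ : MvPolynomial (Fin 6) K := X 4
  X₁ * X₃ * X₅ - C (3 / 2) * X₁ * X₄ - C (1 / 2) * X₂ * X₅ + C (1 / 2) * X₃ ^ 2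

/-- `Ω₂ = X₂X₄X₆ - (2/3)X₃³X₆ - (2/3)X₂X₅³ + 2X₃²X₅² - 3X₃X₄X₅ + (3/2)X₄²`. -/
noncomputable def Omega₂ (K : Type*) [Field K] : MvPolynomial (Fin 6) K :=
  let X₂ : MvPolynomial (Fin 6) K := X 1
  let X₃ : MvPolynomial (Fin 6) K := X 2
  let X₄ : MvPolynomial (Fin 6) K := X 3
  let X₅ : MvPolynomial (Fin 6) K := X 4
  let X₆ : MvPolynomial (Fin 6) K := X 5
  X₂ * X₄ * X₆ - C (2 / 3) * X₃ ^ 3 * X₆ - C (2 / 3) * X₂ * X₅ ^ 3 + 2 * X₃ ^ 2 * X₅ ^ 2 -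
    3 * X₃ * X₄ * X₅ + C (3 / 2) * X₄ ^ 2

theorem Omega₁_central (K : Type*) [Field K] [CharZero K] (f : MvPolynomial (Fin 6) K) :
    (poisson K).bracket (Omega₁ K) f = 0 := by
  refine bracketMap_eq_zero K (fun i => ?_) f
  rw [bracketMap_skew, neg_eq_zero]
  have h2 : (C (3 / 2) : MvPolynomial (Fin 6) K) = 3 * C (1 / 2) := by
    rw [← map_ofNat C 3, ← C_mul]; norm_num
  have h1 : (2 : MvPolynomial (Fin 6) K) * C (1 / 2) = 1 := by
    rw [← map_ofNat C 2, ← C_mul]; norm_num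
  have hΩ : Omega₁ K = C (1 / 2) * (2 * X 0 * X 2 * X 4 - 3 * X 0 * X 3 - X 1 * X 4 + X 2 ^ 2) := by
    simp only [Omega₁, h2]
    linear_combination (-(X 0 * X 2 * X 4)) * h1
  have hC (f) (a : K) : bracketMap K f (C a) = 0 := bracketMap_C K f a
  have n2 (f) : bracketMap K f 2 = 0 := by exact_mod_cast bracketMap_natCast K f 2
  have n3 (f) : bracketMap K f 3 = 0 := by exact_mod_cast bracketMap_natCast K f 3
  rw [hΩ, bracketMap_leibniz, hC, zero_mul, zero_add]
  refine mul_eq_zero_of_right _ ?_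
  fin_cases i <;>
    simp [gen, lower, bracketMap_leibniz, bracketMap_pow, n2, n3,
      bracketMap_X_X] <;> ring

theorem Omega₂_central (K : Type*) [Field K] [CharZero K] (f : MvPolynomial (Fin 6) K) :
    (poisson K).bracket (Omega₂ K) f = 0 := by
  refine bracketMap_eq_zero K (fun i => ?_) f
  rw [bracketMap_skew, neg_eq_zero]
  have h2 : (C (3 / 2) : MvPolynomial (Fin 6) K) = 9 * C (1 / 6) := by
    rw [← map_ofNat C 9, ← C_mul]; norm_num
  have h3 : (C (2 / 3) : MvPolynomial (Fin 6) K) = 4 * C (1 / 6) := by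
    rw [← map_ofNat C 4, ← C_mul]; norm_num
  have h1 : (6 : MvPolynomial (Fin 6) K) * C (1 / 6) = 1 := by
    rw [← map_ofNat C 6, ← C_mul]; norm_num
  have hΩ : Omega₂ K = C (1 / 6) * (6 * X 1 * X 3 * X 5 - 4 * X 2 ^ 3 * X 5 - 4 * X 1 * X 4 ^ 3 +
      12 * X 2 ^ 2 * X 4 ^ 2 - 18 * X 2 * X 3 * X 4 + 9 * X 3 ^ 2) := by
    simp only [Omega₂, h2, h3]
    linear_combination (-(X 1 * X 3 * X 5 + 2 * X 2 ^ 2 * X 4 ^ 2 - 3 * X 2 * X 3 * X 4)) * h1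
  have hC (f) (a : K) : bracketMap K f (C a) = 0 := bracketMap_C K f a
  have n4 (f) : bracketMap K f 4 = 0 := by exact_mod_cast bracketMap_natCast K f 4
  have n6 (f) : bracketMap K f 6 = 0 := by exact_mod_cast bracketMap_natCast K f 6
  have n9 (f) : bracketMap K f 9 = 0 := by exact_mod_cast bracketMap_natCast K f 9
  have n12 (f) : bracketMap K f 12 = 0 := by exact_mod_cast bracketMap_natCast K f 12
  have n18 (f) : bracketMap K f 18 = 0 := by exact_mod_cast bracketMap_natCast K f 18
  rw [hΩ, bracketMap_leibniz, hC, zero_mul, zero_add]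
  refine mul_eq_zero_of_right _ ?_
  fin_cases i <;>
    simp [gen, lower, bracketMap_leibniz, bracketMap_pow, n4, n6, n9, n12, n18,
      bracketMap_X_X] <;> ring

/-- The ideal `⟨Ω₁ - α, Ω₂ - β⟩` of `𝒜`. -/
noncomputable def ideal {K : Type*} [Field K] (α β : K) : Ideal (MvPolynomial (Fin 6) K) :=
  Ideal.span {Omega₁ K - C α, Omega₂ K - C β}

theorem isPoissonIdeal_ideal {K : Type*} [Field K] [CharZero K] (α β : K) :
    (poisson K).IsPoissonIdeal (ideal α β) := by
  intro x y hy
  obtain ⟨a, b, rfl⟩ := Ideal.mem_span_pair.1 hy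
  have h1 : (poisson K).bracket x (Omega₁ K - C α) = 0 := by
    rw [map_sub, (poisson K).skew, Omega₁_central, neg_zero, zero_sub, neg_eq_zero]
    exact bracketMap_C K x α
  have h2 : (poisson K).bracket x (Omega₂ K - C β) = 0 := by
    rw [map_sub, (poisson K).skew, Omega₂_central, neg_zero, zero_sub, neg_eq_zero]
    exact bracketMap_C K x β
  rw [map_add, (poisson K).leibniz, (poisson K).leibniz, h1, h2, mul_zero, mul_zero, add_zero,
    add_zero]
  exact Ideal.mem_span_pair.2 ⟨_, _, rfl⟩

/-- The algebra `𝒜_{α,β} = 𝒜 / ⟨Ω₁ - α, Ω₂ - β⟩`. -/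
abbrev QuotientAlgebra {K : Type*} [Field K] (α β : K) : Type _ := MvPolynomial (Fin 6) K ⧸ ideal α β

/-- The induced Poisson bracket on `𝒜_{α,β}`. -/
noncomputable def quotientPoisson {K : Type*} [Field K] [CharZero K] (α β : K) :
    PoissonBracket K (QuotientAlgebra α β) :=
  (poisson K).quotient (ideal α β) (isPoissonIdeal_ideal α β)

end G2

/-! Write I = ⟨Ω₁ − α, Ω₂ − β⟩, u = 2X₃X₅ − 3X₄, v = X₂X₅ − X₃² and w = 3X₂X₄ − 2X₃³.

Primality. Here 2Ω₁ = uX₁ − v, and 3Ω₂ is wX₆ plus a polynomial in X₂, …, X₅, so once uw is inverted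
the quotient by I becomes a localisation of K[X₂, …, X₅], a domain. It remains to see that u and w
are non-zero-divisors modulo I. By `IsPoissonIdeal.mem_of_mul_mem` it suffices that a radical
Poisson ideal containing I and u (or w) is everything: brackets with X₁ and X₆ force such an ideal
to contain Ω₁ and Ω₂, hence α and β, one of which is a unit.

Maximality. Over an algebraically closed field, let p be a zero of a proper Poisson ideal J ⊇ I. The
4 × 4 Pfaffians of the bracket matrix are, up to sign and a factor 2, the 2 × 2 Jacobian minors of
2Ω₁, 6Ω₂ (`jacobianMinor_cyclic_mem`), and two weighted Euler relations show that these do not all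
vanish at p (`exists_eval_jacobianMinor_ne_zero`). So the level set is symplectic at p, Hamiltonian
fields span its tangent directions, and elements of J vanish at p to every order along it
(`mem_pow_succ_sup_of_bracket_mem`). Krull's intersection theorem in the domain 𝒜/I gives J = I. A
general field is reduced to its algebraic closure by faithful flatness. -/

namespace PoissonBracket

/-! ### Radicals, saturations and colons of Poisson ideals -/

section Field

variable {K A : Type*} [Field K] [CommRing A] [Algebra K A]

/-- The Hamiltonian derivation `{x, ·}`. -/
def hamiltonian (P : PoissonBracket K A) (x : A) : Derivation K A A :=
  Derivation.mk' (P.bracket x) fun a b => by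
    rw [P.leibniz, smul_eq_mul, smul_eq_mul]; ring

theorem hamiltonian_apply (P : PoissonBracket K A) (x y : A) :
    P.hamiltonian x y = P.bracket x y := rfl

theorem _root_.Ideal.mem_of_natCast_mul_mem [CharZero K] {I : Ideal A} {n : ℕ} (hn : n ≠ 0) {a : A}
    (h : (n : A) * a ∈ I) : a ∈ I := by
  have h1 : algebraMap K A (n : K)⁻¹ * (n : A) = 1 := by
    rw [← map_natCast (algebraMap K A), ← map_mul, inv_mul_cancel₀ (Nat.cast_ne_zero.2 hn), map_one]
  have := I.mul_mem_left (algebraMap K A (n : K)⁻¹) h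
  rwa [← mul_assoc, h1, one_mul] at this

/-- The extra factor d removes the exponent e − 1 from the power rule, so that e = 0 needs no
separate treatment later. -/
theorem _root_.Derivation.mul_apply_pow (D : Derivation K A A) (d : A) (e : ℕ) :
    d * D (d ^ e) = e * d ^ e * D d := by
  rw [D.leibniz_pow]
  cases e with
  | zero => simp
  | succ e => simp only [Nat.add_sub_cancel, smul_eq_mul, nsmul_eq_mul]; ring

/-- Apply D to a^(m+1) (Da)^e and multiply by Da: one term is (m+1) a^m (Da)^(e+2), and the other is
a multiple of the original element. -/
theorem _root_.Derivation.pow_mul_pow_mem [CharZero K] (D : Derivation K A A) {I : Ideal A}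
    (hD : ∀ y ∈ I, D y ∈ I) (a : A) (m e : ℕ) (h : a ^ (m + 1) * D a ^ e ∈ I) :
    a ^ m * D a ^ (e + 2) ∈ I := by
  apply Ideal.mem_of_natCast_mul_mem (K := K) m.succ_ne_zero
  have h1 := I.sub_mem (I.mul_mem_left (D a) (hD _ h)) (I.mul_mem_left (e * D (D a)) h)
  rw [D.leibniz, D.leibniz_pow a, Nat.add_sub_cancel] at h1
  convert h1 using 1
  simp only [smul_eq_mul, nsmul_eq_mul]
  linear_combination (-a ^ (m + 1)) * D.mul_apply_pow (D a) e

/-- In characteristic zero the radical of an ideal stable under a derivation is stable. -/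
theorem _root_.Derivation.apply_mem_radical [CharZero K] (D : Derivation K A A) {I : Ideal A}
    (hD : ∀ y ∈ I, D y ∈ I) {a : A} (ha : a ∈ I.radical) : D a ∈ I.radical := by
  obtain ⟨n, hn⟩ := ha
  -- Each factor a is traded for two factors Da, so a^n ∈ I ends as (Da)^(2n) ∈ I.
  have key : ∀ k m : ℕ, k + m = n → a ^ m * D a ^ (2 * k) ∈ I := by
    intro k
    induction k with
    | zero => intro m hm; simpa [← hm] using hn
    | succ k ih =>
      intro m hm
      exact D.pow_mul_pow_mem hD a m (2 * k) (ih (m + 1) (by omega))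
  exact ⟨2 * n, by simpa using key n 0 (by simp)⟩

theorem IsPoissonIdeal.radical [CharZero K] {P : PoissonBracket K A} {I : Ideal A}
    (hI : P.IsPoissonIdeal I) : P.IsPoissonIdeal I.radical :=
  fun x _ hy => (P.hamiltonian x).apply_mem_radical (hI x) hy

/-- The saturation of an ideal at an element. -/
def _root_.Ideal.saturationAt (I : Ideal A) (s : A) : Ideal A where
  carrier := {g | ∃ n : ℕ, s ^ n * g ∈ I}
  zero_mem' := ⟨0, by simp⟩
  add_mem' := by
    rintro a b ⟨m, hm⟩ ⟨n, hn⟩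
    refine ⟨m + n, ?_⟩
    convert I.add_mem (I.mul_mem_left (s ^ n) hm) (I.mul_mem_left (s ^ m) hn) using 1
    ring
  smul_mem' := by
    rintro c a ⟨m, hm⟩
    refine ⟨m, ?_⟩
    convert I.mul_mem_left c hm using 1
    simp only [smul_eq_mul]; ring

theorem IsPoissonIdeal.saturationAt {P : PoissonBracket K A} {I : Ideal A}
    (hI : P.IsPoissonIdeal I) (s : A) : P.IsPoissonIdeal (I.saturationAt s) := by
  rintro x g ⟨n, hn⟩
  -- s^(n+1){x, g} = s{x, s^n g} − n{x, s} s^n g, and both terms lie in I.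
  refine ⟨n + 1, ?_⟩
  have h1 := I.sub_mem (I.mul_mem_left s (hI x _ hn))
    (I.mul_mem_left (n * P.bracket x s) hn)
  convert h1 using 1
  have h2 := (P.hamiltonian x).mul_apply_pow s n
  rw [hamiltonian_apply, hamiltonian_apply] at h2
  rw [P.leibniz]
  linear_combination (-g) * h2

/-- The colon ideal of two Poisson ideals is a Poisson ideal. -/
theorem IsPoissonIdeal.exists_colon {P : PoissonBracket K A} {I N : Ideal A}
    (hI : P.IsPoissonIdeal I) (hN : P.IsPoissonIdeal N) :
    ∃ Q : Ideal A, P.IsPoissonIdeal Q ∧ ∀ h, h ∈ Q ↔ ∀ g ∈ N, h * g ∈ I := by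
  refine ⟨⟨⟨⟨{h | ∀ g ∈ N, h * g ∈ I}, ?_⟩, ?_⟩, ?_⟩, ?_, fun h => Iff.rfl⟩
  · intro a b ha hb g hg
    rw [add_mul]
    exact I.add_mem (ha g hg) (hb g hg)
  · intro g _
    simp
  · intro c a ha g hg
    rw [smul_eq_mul, mul_assoc]
    exact I.mul_mem_left c (ha g hg)
  · intro x h hh g hg
    have h1 := I.sub_mem (hI x _ (hh g hg)) (hh _ (hN x g hg))
    rwa [P.leibniz, add_sub_cancel_right] at h1

/-- The saturation is finitely generated, so the largest exponent needed by a generator serves for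
all its elements. -/
theorem _root_.Ideal.exists_pow_mul_saturationAt_mem [IsNoetherianRing A] (I : Ideal A) (s : A) :
    ∃ n : ℕ, ∀ g ∈ I.saturationAt s, s ^ n * g ∈ I := by
  obtain ⟨S, hS⟩ := IsNoetherian.noetherian (I.saturationAt s)
  have hS' : ∀ g : A, ∃ n : ℕ, g ∈ S → s ^ n * g ∈ I := by
    intro g
    by_cases hg : g ∈ S
    · have : g ∈ I.saturationAt s := hS ▸ Submodule.subset_span hg
      obtain ⟨n, hn⟩ := this
      exact ⟨n, fun _ => hn⟩
    · exact ⟨0, fun h => absurd h hg⟩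
  choose n hn using hS'
  refine ⟨S.sup n, fun g hg => ?_⟩
  rw [← hS] at hg
  induction hg using Submodule.span_induction with
  | mem g hg =>
    obtain ⟨k, hk⟩ := Nat.exists_eq_add_of_le (Finset.le_sup (f := n) hg)
    rw [hk, pow_add, mul_comm (s ^ _), mul_assoc]
    exact I.mul_mem_left _ (hn g hg)
  | zero => simp
  | add a b _ _ ha hb => rw [mul_add]; exact I.add_mem ha hb
  | smul c a _ ha => rw [smul_eq_mul, mul_left_comm]; exact I.mul_mem_left c ha

/-- If no proper radical Poisson ideal contains both the Poisson ideal `I` and `s`, then `s` is a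
non-zero-divisor modulo `I`. -/
theorem IsPoissonIdeal.mem_of_mul_mem [CharZero K] [IsNoetherianRing A] {P : PoissonBracket K A}
    {I : Ideal A} (hI : P.IsPoissonIdeal I) {s : A}
    (hs : ∀ J : Ideal A, P.IsPoissonIdeal J → J.IsRadical → I ≤ J → s ∈ J → J = ⊤)
    {f : A} (hf : s * f ∈ I) : f ∈ I := by
  obtain ⟨n, hn⟩ := I.exists_pow_mul_saturationAt_mem s
  -- Q = (I : saturation) is Poisson and contains I and a power of s, so its radical is everything
  -- by `hs`; then 1 ∈ Q says that I is already saturated.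
  obtain ⟨Q, hQ, hQ'⟩ := hI.exists_colon (hI.saturationAt s)
  have h1 : Q.radical = ⊤ := by
    refine hs _ hQ.radical Q.radical_isRadical ?_ ⟨n, (hQ' _).2 hn⟩
    exact le_trans (fun a ha => (hQ' a).2 fun g _ => I.mul_mem_right g ha) Ideal.le_radical
  rw [Ideal.radical_eq_top] at h1
  have h2 := (hQ' 1).1 (h1 ▸ Submodule.mem_top) f ⟨1, by rwa [pow_one]⟩
  rwa [one_mul] at h2

end Field

variable {K A : Type*} [CommRing K] [CommRing A] [Algebra K A]

theorem IsPoissonIdeal.isPoissonPrime {P : PoissonBracket K A} {I : Ideal A}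
    (hI : P.IsPoissonIdeal I) (h : I.IsPrime) : P.IsPoissonPrime I :=
  ⟨hI, h.ne_top, fun _ _ _ _ hle => h.mul_le.1 hle⟩

theorem IsMaximalPoissonIdeal.isPoissonSimple_quotient {P : PoissonBracket K A} {I : Ideal A}
    (hI : P.IsPoissonIdeal I) (h : P.IsMaximalPoissonIdeal I) :
    (P.quotient I hI).IsPoissonSimple := by
  refine ⟨Ideal.Quotient.nontrivial_iff.2 h.2.1, fun J hJ => or_iff_not_imp_right.2 fun hne => ?_⟩
  have hle : I ≤ J.comap (Ideal.Quotient.mk I) := by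
    intro x hx
    rw [Ideal.mem_comap, Ideal.Quotient.eq_zero_iff_mem.2 hx]
    exact J.zero_mem
  have h1 := h.2.2 (J.comap (Ideal.Quotient.mk I)) (fun x y hy => hJ (Ideal.Quotient.mk I x) _ hy)
    hle (Ideal.comap_ne_top _ hne)
  rw [← Ideal.map_comap_of_surjective _ Ideal.Quotient.mk_surjective J, h1, Ideal.map_quotient_self]

end PoissonBracket

/-! ### Euler fields and order of vanishing at a point -/

namespace MvPolynomial

variable {σ L : Type*}

/-- The Euler vector field `∑ i, (X i - p i) ∂/∂X i` at the point `p`, applied to `f`. -/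
noncomputable def eulerAt [Fintype σ] [CommRing L] (p : σ → L) (f : MvPolynomial σ L) : MvPolynomial σ L :=
  ∑ i, (X i - C (p i)) * pderiv i f

section CommRing

variable [CommRing L] (p : σ → L)

theorem X_sub_C_mem_ker_eval (i : σ) : X i - C (p i) ∈ RingHom.ker (eval p) := by
  simp [RingHom.mem_ker]

theorem sub_C_eval_mem_ker_eval (f : MvPolynomial σ L) :
    f - C (eval p f) ∈ RingHom.ker (eval p) := by
  simp [RingHom.mem_ker]

variable [Fintype σ]

theorem eulerAt_mul (f g : MvPolynomial σ L) :
    eulerAt p (f * g) = eulerAt p f * g + f * eulerAt p g := by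
  simp only [eulerAt, Derivation.leibniz, smul_eq_mul, Finset.sum_mul, Finset.mul_sum,
    ← Finset.sum_add_distrib]
  exact Finset.sum_congr rfl fun i _ => by ring

theorem eulerAt_add (f g : MvPolynomial σ L) :
    eulerAt p (f + g) = eulerAt p f + eulerAt p g := by
  simp only [eulerAt, map_add, mul_add, Finset.sum_add_distrib]

theorem eulerAt_C (a : L) : eulerAt p (C a) = 0 := by
  simp [eulerAt]

theorem eulerAt_X (i : σ) : eulerAt p (X i) = X i - C (p i) := by
  classical
  simp [eulerAt, pderiv_X, Pi.single_apply]

theorem eulerAt_mem_ker_eval (f : MvPolynomial σ L) : eulerAt p f ∈ RingHom.ker (eval p) :=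
  Ideal.sum_mem _ fun i _ => Ideal.mul_mem_right _ _ (X_sub_C_mem_ker_eval p i)

/-- First order Taylor expansion at `p`. -/
theorem eulerAt_sub_mem_ker_eval_sq (f : MvPolynomial σ L) :
    eulerAt p f - (f - C (eval p f)) ∈ RingHom.ker (eval p) ^ 2 := by
  induction f using MvPolynomial.induction_on with
  | C a => simp [eulerAt_C]
  | add f g hf hg =>
    convert Ideal.add_mem _ hf hg using 1
    simp only [eulerAt_add, map_add]; ring
  | mul_X f i hf =>
    have h1 : (f - C (eval p f)) * (X i - C (p i)) ∈ RingHom.ker (eval p) ^ 2 := by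
      rw [pow_two]
      exact Ideal.mul_mem_mul (sub_C_eval_mem_ker_eval p f) (X_sub_C_mem_ker_eval p i)
    convert Ideal.add_mem _ (Ideal.mul_mem_left _ (X i) hf) h1 using 1
    simp only [eulerAt_mul, eulerAt_X, map_mul, eval_X]; ring

/-- With m the maximal ideal of p, the Euler field is a derivation inducing the identity on m/m²,
hence multiplication by n on mⁿ/mⁿ⁺¹. In characteristic zero this recovers the leading part of f
from its partial derivatives. -/
theorem eulerAt_sub_mem_ker_eval_pow (n : ℕ) {f : MvPolynomial σ L}
    (hf : f ∈ RingHom.ker (eval p) ^ n) :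
    eulerAt p f - n * f ∈ RingHom.ker (eval p) ^ (n + 1) := by
  induction n generalizing f with
  | zero => simpa using eulerAt_mem_ker_eval p f
  | succ n ih =>
    rw [pow_succ] at hf
    induction hf using Submodule.mul_induction_on' with
    | mem_mul_mem g hg h hh =>
      have h1 := Ideal.mul_mem_mul (ih hg) hh
      have h2 := eulerAt_sub_mem_ker_eval_sq p h
      rw [RingHom.mem_ker.1 hh, C_0, sub_zero] at h2
      have h3 := Ideal.mul_mem_mul hg h2
      rw [← pow_succ] at h1
      rw [← pow_add] at h3
      convert Ideal.add_mem _ h1 h3 using 1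
      rw [eulerAt_mul]; push_cast; ring
    | add x _ y _ hx hy =>
      convert Ideal.add_mem _ hx hy using 1
      rw [eulerAt_add]; ring

end CommRing

end MvPolynomial

theorem Derivation.apply_mem_pow {R A : Type*} [CommRing R] [CommRing A] [Algebra R A]
    (D : Derivation R A A) (I : Ideal A) (n : ℕ) {f : A} (hf : f ∈ I ^ (n + 1)) : D f ∈ I ^ n := by
  induction n generalizing f with
  | zero => simp
  | succ n ih =>
    rw [pow_succ] at hf
    induction hf using Submodule.mul_induction_on' with
    | mem_mul_mem g hg h hh =>
      rw [D.leibniz, smul_eq_mul, smul_eq_mul]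
      refine Ideal.add_mem _ (Ideal.mul_mem_right _ _ hg) ?_
      rw [mul_comm, pow_succ]
      exact Ideal.mul_mem_mul (ih hg) hh
    | add x _ y _ hx hy => rw [map_add]; exact Ideal.add_mem _ hx hy

/-! ### The Jacobian of the Casimirs and the Poisson bivector -/

namespace G2

variable {K : Type*} [Field K]

/-- The gradient of `2 Ω₁`. -/
noncomputable def gradOmega₁ (K : Type*) [Field K] : Fin 6 → MvPolynomial (Fin 6) K :=
  ![2 * X 2 * X 4 - 3 * X 3, -X 4, 2 * X 0 * X 4 + 2 * X 2, -3 * X 0, 2 * X 0 * X 2 - X 1, 0]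

/-- The gradient of `6 Ω₂`. -/
noncomputable def gradOmega₂ (K : Type*) [Field K] : Fin 6 → MvPolynomial (Fin 6) K :=
  ![0, 6 * X 3 * X 5 - 4 * X 4 ^ 3, -12 * X 2 ^ 2 * X 5 + 24 * X 2 * X 4 ^ 2 - 18 * X 3 * X 4,
    6 * X 1 * X 5 - 18 * X 2 * X 4 + 18 * X 3,
    -12 * X 1 * X 4 ^ 2 + 24 * X 2 ^ 2 * X 4 - 18 * X 2 * X 3, 6 * X 1 * X 3 - 4 * X 2 ^ 3]

theorem two_mul_Omega₁ [CharZero K] : 2 * Omega₁ K =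
    2 * X 0 * X 2 * X 4 - 3 * X 0 * X 3 - X 1 * X 4 + X 2 ^ 2 := by
  have h2 : (2 : MvPolynomial (Fin 6) K) * C (3 / 2) = 3 := by
    rw [← map_ofNat C 2, ← C_mul, ← map_ofNat C 3]; norm_num
  have h1 : (2 : MvPolynomial (Fin 6) K) * C (1 / 2) = 1 := by
    rw [← map_ofNat C 2, ← C_mul]; norm_num
  simp only [Omega₁]
  linear_combination (-X 0 * X 3) * h2 + (X 2 ^ 2 - X 1 * X 4) * h1

theorem six_mul_Omega₂ [CharZero K] : 6 * Omega₂ K =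
    6 * X 1 * X 3 * X 5 - 4 * X 2 ^ 3 * X 5 - 4 * X 1 * X 4 ^ 3 +
      12 * X 2 ^ 2 * X 4 ^ 2 - 18 * X 2 * X 3 * X 4 + 9 * X 3 ^ 2 := by
  have h2 : (6 : MvPolynomial (Fin 6) K) * C (3 / 2) = 9 := by
    rw [← map_ofNat C 6, ← C_mul, ← map_ofNat C 9]; norm_num
  have h1 : (6 : MvPolynomial (Fin 6) K) * C (2 / 3) = 4 := by
    rw [← map_ofNat C 6, ← C_mul, ← map_ofNat C 4]; norm_num
  simp only [Omega₂]
  linear_combination (X 3 ^ 2) * h2 - (X 2 ^ 3 * X 5 + X 1 * X 4 ^ 3) * h1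

theorem pderiv_ofNat_mul (n : ℕ) [n.AtLeastTwo] (i : Fin 6) (f : MvPolynomial (Fin 6) K) :
    pderiv i (OfNat.ofNat n * f) = OfNat.ofNat n * pderiv i f := by
  rw [← map_ofNat C n, pderiv_C_mul]

theorem two_mul_pderiv_Omega₁ [CharZero K] (i : Fin 6) :
    2 * pderiv i (Omega₁ K) = gradOmega₁ K i := by
  rw [← pderiv_ofNat_mul, two_mul_Omega₁]
  have n2 (i) : pderiv i (2 : MvPolynomial (Fin 6) K) = 0 := (pderiv i).map_natCast 2
  have n3 (i) : pderiv i (3 : MvPolynomial (Fin 6) K) = 0 := (pderiv i).map_natCast 3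
  fin_cases i <;> simp [gradOmega₁, Derivation.leibniz, Derivation.leibniz_pow, pderiv_X,
    n2, n3] <;> ring

theorem six_mul_pderiv_Omega₂ [CharZero K] (i : Fin 6) :
    6 * pderiv i (Omega₂ K) = gradOmega₂ K i := by
  rw [← pderiv_ofNat_mul, six_mul_Omega₂]
  have n4 (i) : pderiv i (4 : MvPolynomial (Fin 6) K) = 0 := (pderiv i).map_natCast 4
  have n6 (i) : pderiv i (6 : MvPolynomial (Fin 6) K) = 0 := (pderiv i).map_natCast 6
  have n9 (i) : pderiv i (9 : MvPolynomial (Fin 6) K) = 0 := (pderiv i).map_natCast 9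
  have n12 (i) : pderiv i (12 : MvPolynomial (Fin 6) K) = 0 := (pderiv i).map_natCast 12
  have n18 (i) : pderiv i (18 : MvPolynomial (Fin 6) K) = 0 := (pderiv i).map_natCast 18
  fin_cases i <;> simp [gradOmega₂, Derivation.leibniz, Derivation.leibniz_pow, pderiv_X,
    n4, n6, n9, n12, n18] <;> ring

/-- The `2 × 2` minors of the Jacobian matrix of `2 Ω₁`, `6 Ω₂`. -/
noncomputable def jacobianMinor (K : Type*) [Field K] (i j : Fin 6) : MvPolynomial (Fin 6) K :=
  gradOmega₁ K i * gradOmega₂ K j - gradOmega₁ K j * gradOmega₂ K i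

theorem bracket_X_left (l : Fin 6) (f : MvPolynomial (Fin 6) K) :
    bracketMap K (X l) f = ∑ j, gen K l j * pderiv j f := by
  simp [bracketMap_apply, pderiv_X, Pi.single_apply]

-- For {p, q, r} complementary to {i, j, k}, the combination in `key` has as coefficient of each v_s
-- twice the Pfaffian of `gen` on p, q, r, s. It vanishes for s ∈ {p, q, r}; otherwise it is the
-- Jacobian minor on the two remaining indices. The order of p, q, r makes (i, j, k, p, q, r) an odd
-- permutation, which fixes the sign.
set_option maxHeartbeats 1000000 in
theorem jacobianMinor_cyclic_mem_of_lt {Q : Ideal (MvPolynomial (Fin 6) K)}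
    {v : Fin 6 → MvPolynomial (Fin 6) K} (h : ∀ l, ∑ j, gen K l j * v j ∈ Q) (i j k : Fin 6)
    (hij : i < j) (hjk : j < k) :
    jacobianMinor K j k * v i + jacobianMinor K k i * v j + jacobianMinor K i j * v k ∈ Q := by
  have key : ∀ (p q r : Fin 6) {t : MvPolynomial (Fin 6) K},
      t = 2 * (gen K q r * ∑ j, gen K p j * v j + gen K r p * ∑ j, gen K q j * v j +
        gen K p q * ∑ j, gen K r j * v j) → t ∈ Q := by
    rintro p q r t rfl
    exact Q.mul_mem_left _ (Q.add_mem (Q.add_mem (Q.mul_mem_left _ (h p)) (Q.mul_mem_left _ (h q)))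
      (Q.mul_mem_left _ (h r)))
  clear h
  unfold jacobianMinor
  fin_cases i <;> fin_cases j <;> first | (exfalso; revert hij; decide) | skip
  all_goals fin_cases k <;> first | (exfalso; revert hjk; decide) | skip
  · exact key 3 5 4 (by simp [gradOmega₁, gradOmega₂, gen, lower, Fin.sum_univ_six]; ring)
  · exact key 2 4 5 (by simp [gradOmega₁, gradOmega₂, gen, lower, Fin.sum_univ_six]; ring)
  · exact key 2 5 3 (by simp [gradOmega₁, gradOmega₂, gen, lower, Fin.sum_univ_six]; ring)
  · exact key 2 3 4 (by simp [gradOmega₁, gradOmega₂, gen, lower, Fin.sum_univ_six]; ring)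
  · exact key 1 5 4 (by simp [gradOmega₁, gradOmega₂, gen, lower, Fin.sum_univ_six]; ring)
  · exact key 1 3 5 (by simp [gradOmega₁, gradOmega₂, gen, lower, Fin.sum_univ_six]; ring)
  · exact key 1 4 3 (by simp [gradOmega₁, gradOmega₂, gen, lower, Fin.sum_univ_six]; ring)
  · exact key 1 5 2 (by simp [gradOmega₁, gradOmega₂, gen, lower, Fin.sum_univ_six]; ring)
  · exact key 1 2 4 (by simp [gradOmega₁, gradOmega₂, gen, lower, Fin.sum_univ_six]; ring)
  · exact key 1 3 2 (by simp [gradOmega₁, gradOmega₂, gen, lower, Fin.sum_univ_six]; ring)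
  · exact key 0 4 5 (by simp [gradOmega₁, gradOmega₂, gen, lower, Fin.sum_univ_six]; ring)
  · exact key 0 5 3 (by simp [gradOmega₁, gradOmega₂, gen, lower, Fin.sum_univ_six]; ring)
  · exact key 0 3 4 (by simp [gradOmega₁, gradOmega₂, gen, lower, Fin.sum_univ_six]; ring)
  · exact key 0 2 5 (by simp [gradOmega₁, gradOmega₂, gen, lower, Fin.sum_univ_six]; ring)
  · exact key 0 4 2 (by simp [gradOmega₁, gradOmega₂, gen, lower, Fin.sum_univ_six]; ring)
  · exact key 0 2 3 (by simp [gradOmega₁, gradOmega₂, gen, lower, Fin.sum_univ_six]; ring)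
  · exact key 0 5 1 (by simp [gradOmega₁, gradOmega₂, gen, lower, Fin.sum_univ_six]; ring)
  · exact key 0 1 4 (by simp [gradOmega₁, gradOmega₂, gen, lower, Fin.sum_univ_six]; ring)
  · exact key 0 3 1 (by simp [gradOmega₁, gradOmega₂, gen, lower, Fin.sum_univ_six]; ring)
  · exact key 0 1 2 (by simp [gradOmega₁, gradOmega₂, gen, lower, Fin.sum_univ_six]; ring)

/-- The bivector of the bracket has square proportional to the dual of `dΩ₁ ∧ dΩ₂`: its kernel is
spanned by `dΩ₁` and `dΩ₂` wherever these are independent. -/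
theorem jacobianMinor_cyclic_mem {Q : Ideal (MvPolynomial (Fin 6) K)}
    {v : Fin 6 → MvPolynomial (Fin 6) K} (h : ∀ l, ∑ j, gen K l j * v j ∈ Q) (i j k : Fin 6) :
    jacobianMinor K j k * v i + jacobianMinor K k i * v j + jacobianMinor K i j * v k ∈ Q := by
  have hd : ∀ i k, jacobianMinor K i k * v i + jacobianMinor K k i * v i +
      jacobianMinor K i i * v k = 0 := by
    intro i k
    unfold jacobianMinor; ring
  have hs : ∀ i j k,
      jacobianMinor K i k * v j + jacobianMinor K k j * v i + jacobianMinor K j i * v k =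
      -(jacobianMinor K j k * v i + jacobianMinor K k i * v j + jacobianMinor K i j * v k) := by
    intro i j k
    unfold jacobianMinor; ring
  have hr : ∀ i j k,
      jacobianMinor K j k * v i + jacobianMinor K k i * v j + jacobianMinor K i j * v k =
      jacobianMinor K i j * v k + jacobianMinor K j k * v i + jacobianMinor K k i * v j := by
    intro i j k; ring
  have L := jacobianMinor_cyclic_mem_of_lt h
  rcases lt_trichotomy i j with h1 | rfl | h1
  · rcases lt_trichotomy j k with h2 | rfl | h2
    · exact L i j k h1 h2
    · rw [hr, hr, hd]; exact Q.zero_mem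
    · rcases lt_trichotomy i k with h3 | rfl | h3
      · rw [hr, hs, neg_mem_iff]; exact L i k j h3 h2
      · rw [hr, hd]; exact Q.zero_mem
      · rw [hr]; exact L k i j h3 h1
  · rw [hd]; exact Q.zero_mem
  · rcases lt_trichotomy i k with h2 | rfl | h2
    · rw [hs, neg_mem_iff]; exact L j i k h1 h2
    · rw [hr, hd]; exact Q.zero_mem
    · rcases lt_trichotomy j k with h3 | rfl | h3
      · rw [hr, hr]; exact L j k i h3 h2
      · rw [hr, hr, hd]; exact Q.zero_mem
      · rw [hs, neg_mem_iff, hr]; exact L k j i h3 h1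

end G2

/-! ### The coefficients u of X₁ and w of X₆ are non-zero-divisors -/

theorem eq_zero_of_natCast_mul_eq_zero (K : Type*) {R : Type*} [Field K] [CharZero K] [CommRing R]
    [Algebra K R] {n : ℕ} (hn : n ≠ 0) {a : R} (h : (n : R) * a = 0) : a = 0 := by
  have := Ideal.mem_of_natCast_mul_mem (K := K) (I := (⊥ : Ideal R)) hn (a := a) (by simpa using h)
  simpa using this

namespace G2

/-- The reduced locus where `X₂X₄ - (2/3)X₃³` and `Ω₂` both vanish. -/
theorem discriminant_locus (K : Type*) {R : Type*} [Field K] [CharZero K] [CommRing R]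
    [Algebra K R] [IsReduced R] {x₂ x₃ x₄ x₅ : R} (hw : 3 * (x₂ * x₄) = 2 * x₃ ^ 3)
    (hk : 9 * x₄ ^ 2 - 18 * (x₃ * x₄ * x₅) - 4 * (x₂ * x₅ ^ 3) + 12 * (x₃ ^ 2 * x₅ ^ 2) = 0) :
    x₂ * x₅ = x₃ ^ 2 ∧ 2 * (x₃ * x₅) = 3 * x₄ := by
  have h1 : x₂ * x₅ = x₃ ^ 2 := by
    rw [← sub_eq_zero]
    refine (pow_eq_zero_iff (n := 3) (by norm_num)).1 ?_
    -- With k the left side of `hk`, 4(x₂x₅ − x₃²)³ + x₂²k is a multiple of 3x₂x₄ − 2x₃³, as in the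
    -- syzygy of a binary cubic; reducedness then kills the cube.
    refine eq_zero_of_natCast_mul_eq_zero K (n := 4) (by norm_num) ?_
    push_cast
    linear_combination (3 * (x₂ * x₄) + 2 * x₃ ^ 3 - 6 * x₂ * x₃ * x₅) * hw - x₂ ^ 2 * hk
  have h2 : x₂ * (2 * (x₃ * x₅) - 3 * x₄) = 0 := by
    linear_combination 2 * x₃ * h1 - hw
  have h3 : x₃ * (2 * (x₃ * x₅) - 3 * x₄) = 0 := by
    refine (pow_eq_zero_iff (n := 2) (by norm_num)).1 ?_
    linear_combination (2 * (x₃ * x₅) - 3 * x₄) * (x₅ * h2 - (2 * (x₃ * x₅) - 3 * x₄) * h1)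
  refine ⟨h1, sub_eq_zero.1 ((pow_eq_zero_iff (n := 2) (by norm_num)).1 ?_)⟩
  linear_combination hk - 2 * x₅ * h3 + 4 * x₅ ^ 2 * h1

section Saturation

variable {K : Type*} [Field K]

theorem eq_top_of_C_mem {α β : K} (hαβ : (α, β) ≠ (0, 0)) {J : Ideal (MvPolynomial (Fin 6) K)}
    (hα : C α ∈ J) (hβ : C β ∈ J) : J = ⊤ := by
  by_cases h : α = 0
  · refine J.eq_top_of_isUnit_mem hβ (IsUnit.map C (IsUnit.mk0 β ?_))
    rintro rfl
    exact hαβ (by rw [h])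
  · exact J.eq_top_of_isUnit_mem hα (IsUnit.map C (IsUnit.mk0 α h))

theorem Omega₁_sub_C_mem (α β : K) : Omega₁ K - C α ∈ ideal α β :=
  Ideal.subset_span (Set.mem_insert _ _)

theorem Omega₂_sub_C_mem (α β : K) : Omega₂ K - C β ∈ ideal α β :=
  Ideal.subset_span (Set.mem_insert_of_mem _ rfl)

/-- A Poisson ideal containing u thus contains v, and both Casimirs lie in the ideal ⟨u, v⟩. -/
theorem bracket_X₁_coeff :
    bracketMap K (X 0) (2 * (X 2 * X 4) - 3 * X 3) = 2 * (X 1 * X 4 - X 2 ^ 2) := by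
  have n2 (f) : bracketMap K f 2 = 0 := by exact_mod_cast bracketMap_natCast K f 2
  have n3 (f) : bracketMap K f 3 = 0 := by exact_mod_cast bracketMap_natCast K f 3
  simp [bracketMap_leibniz, bracketMap_X_X, gen, lower, n2, n3]
  ring

variable [CharZero K]

/-- A Poisson ideal containing w thus contains Ω₂. -/
theorem bracket_X₆_coeff :
    bracketMap K (X 5) (3 * (X 1 * X 3) - 2 * X 2 ^ 3) =
      18 * Omega₂ K - 6 * X 5 * (3 * (X 1 * X 3) - 2 * X 2 ^ 3) := by
  have n2 (f) : bracketMap K f 2 = 0 := by exact_mod_cast bracketMap_natCast K f 2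
  have n3 (f) : bracketMap K f 3 = 0 := by exact_mod_cast bracketMap_natCast K f 3
  have h : (18 : MvPolynomial (Fin 6) K) * Omega₂ K = 3 * (6 * Omega₂ K) := by ring
  rw [h, six_mul_Omega₂]
  simp [bracketMap_leibniz, bracketMap_pow, bracketMap_X_X, gen, lower, n2, n3]
  ring

/-- The coefficient of `X₁` in `2 Ω₁` is a non-zero-divisor modulo `⟨Ω₁ - α, Ω₂ - β⟩`. -/
theorem mem_ideal_of_X₁_coeff_mul_mem {α β : K} (hαβ : (α, β) ≠ (0, 0))
    {f : MvPolynomial (Fin 6) K} (hf : (2 * (X 2 * X 4) - 3 * X 3) * f ∈ ideal α β) :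
    f ∈ ideal α β := by
  refine (isPoissonIdeal_ideal α β).mem_of_mul_mem (fun J hJ _ hle hu => ?_) hf
  have h1 := hle (Omega₁_sub_C_mem α β)
  have h2 := hle (Omega₂_sub_C_mem α β)
  have hv : X 1 * X 4 - X 2 ^ 2 ∈ J := by
    refine Ideal.mem_of_natCast_mul_mem (K := K) two_ne_zero ?_
    have := hJ (X 0) _ hu
    rw [show (poisson K).bracket = bracketMap K from rfl, bracket_X₁_coeff] at this
    exact_mod_cast this
  refine eq_top_of_C_mem hαβ ?_ ?_
  -- 2Ω₁ = X₁u − v.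
  · refine Ideal.mem_of_natCast_mul_mem (K := K) two_ne_zero ?_
    have h3 := J.sub_mem (J.sub_mem (J.mul_mem_left (X 0) hu) hv) (J.mul_mem_left 2 h1)
    convert h3 using 1
    push_cast
    linear_combination two_mul_Omega₁ (K := K)
  · refine Ideal.mem_of_natCast_mul_mem (K := K) (n := 6) (by norm_num) ?_
    have h3 := J.sub_mem (J.add_mem (J.mul_mem_left (4 * (X 2 * X 5 - X 4 ^ 2)) hv)
      (J.mul_mem_left (2 * (X 2 * X 4) - 3 * X 3 - 2 * X 1 * X 5 + 2 * X 2 * X 4) hu))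
      (J.mul_mem_left 6 h2)
    convert h3 using 1
    push_cast
    linear_combination six_mul_Omega₂ (K := K)

/-- The coefficient of `X₆` in `3 Ω₂` is a non-zero-divisor modulo `⟨Ω₁ - α, Ω₂ - β⟩`. -/
theorem mem_ideal_of_X₆_coeff_mul_mem {α β : K} (hαβ : (α, β) ≠ (0, 0))
    {f : MvPolynomial (Fin 6) K} (hf : (3 * (X 1 * X 3) - 2 * X 2 ^ 3) * f ∈ ideal α β) :
    f ∈ ideal α β := by
  refine (isPoissonIdeal_ideal α β).mem_of_mul_mem (fun J hJ hrad hle hw => ?_) hf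
  have h1 := hle (Omega₁_sub_C_mem α β)
  have h2 := hle (Omega₂_sub_C_mem α β)
  have hΩ : Omega₂ K ∈ J := by
    refine Ideal.mem_of_natCast_mul_mem (K := K) (n := 18) (by norm_num) ?_
    have h3 := J.add_mem (hJ (X 5) _ hw) (J.mul_mem_left (6 * X 5) hw)
    rw [show (poisson K).bracket = bracketMap K from rfl, bracket_X₆_coeff, sub_add_cancel] at h3
    exact_mod_cast h3
  -- This is 6Ω₂ − 2X₆w, the part of 6Ω₂ free of X₆.
  have hk : 9 * X 3 ^ 2 - 18 * (X 2 * X 3 * X 4) - 4 * (X 1 * X 4 ^ 3) +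
      12 * (X 2 ^ 2 * X 4 ^ 2) ∈ J := by
    have h3 := J.sub_mem (J.mul_mem_left 6 hΩ) (J.mul_mem_left (2 * X 5) hw)
    convert h3 using 1
    linear_combination -six_mul_Omega₂ (K := K)
  have : IsReduced (MvPolynomial (Fin 6) K ⧸ J) :=
    (Ideal.isRadical_iff_quotient_reduced J).1 hrad
  rw [← Ideal.Quotient.eq_zero_iff_mem] at hw hk
  simp only [map_sub, map_add, map_mul, map_pow, map_ofNat] at hw hk
  -- Radicality of J is used here: w and Ω₂ yield u and v only up to nilpotents.
  obtain ⟨hv, hu⟩ := discriminant_locus K (sub_eq_zero.1 hw) hk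
  refine eq_top_of_C_mem hαβ ?_ ?_
  · refine Ideal.mem_of_natCast_mul_mem (K := K) two_ne_zero ?_
    rw [← Ideal.Quotient.eq_zero_iff_mem] at h1 ⊢
    have h3 := congrArg (Ideal.Quotient.mk J) (two_mul_Omega₁ (K := K))
    simp only [map_sub, map_add, map_mul, map_pow, map_ofNat, map_natCast] at h1 h3 ⊢
    push_cast
    linear_combination -2 * h1 + h3 + Ideal.Quotient.mk J (X 0) * hu - hv
  · convert J.sub_mem hΩ h2 using 1
    ring

end Saturation

/-! ### Primality by means of the generic point -/

section Prime

variable {K : Type*} [Field K]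


/-- The numerator of `X₁` after solving `Ω₁ = α`. -/
noncomputable def numX₁ (α : K) : MvPolynomial (Fin 6) K := X 1 * X 4 - X 2 ^ 2 + C (2 * α)

/-- The numerator of `X₆` after solving `Ω₂ = β`. -/
noncomputable def numX₆ (β : K) : MvPolynomial (Fin 6) K :=
  C (3 * β) + C (1 / 2) * (4 * X 1 * X 4 ^ 3 - 12 * X 2 ^ 2 * X 4 ^ 2 + 18 * X 2 * X 3 * X 4 -
    9 * X 3 ^ 2)

/-- The projection of `K[X₁, …, X₆]` onto `K[X₂, …, X₅]`. -/
noncomputable def middle (K : Type*) [Field K] :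
    MvPolynomial (Fin 6) K →ₐ[K] MvPolynomial (Fin 6) K :=
  aeval ![0, X 1, X 2, X 3, X 4, 0]

theorem middle_X (i : Fin 6) :
    middle K (X i) = (![0, X 1, X 2, X 3, X 4, 0] : Fin 6 → MvPolynomial (Fin 6) K) i :=
  aeval_X _ _

/-- The generic point of `Ω₁ = α`, `Ω₂ = β`. -/
noncomputable def genericPoint (α β : K) :
    MvPolynomial (Fin 6) K →ₐ[K] FractionRing (MvPolynomial (Fin 6) K) :=
  let a := algebraMap (MvPolynomial (Fin 6) K) (FractionRing (MvPolynomial (Fin 6) K))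
  aeval ![a (numX₁ α) / a (2 * (X 2 * X 4) - 3 * X 3), a (X 1), a (X 2), a (X 3), a (X 4),
    a (numX₆ β) / a (3 * (X 1 * X 3) - 2 * X 2 ^ 3)]

/-- X₂, …, X₅ stay independent at the generic point, so `genericPoint` is injective on K[X₂, …, X₅].
-/
theorem genericPoint_middle (α β : K) (g : MvPolynomial (Fin 6) K) :
    genericPoint α β (middle K g) = algebraMap _ _ (middle K g) := by
  have : (genericPoint α β).comp (middle K) =
      (IsScalarTower.toAlgHom K _ (FractionRing (MvPolynomial (Fin 6) K))).comp (middle K) := by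
    ext i
    fin_cases i <;> simp [genericPoint, middle]
  exact DFunLike.congr_fun this g

theorem middle_numX₁ (α : K) : middle K (numX₁ α) = numX₁ α := by
  simp [middle_X, numX₁, algebraMap_eq]

theorem middle_numX₆ (β : K) : middle K (numX₆ β) = numX₆ β := by
  simp [middle_X, numX₆, algebraMap_eq, map_ofNat (middle K)]

theorem middle_X₁_coeff :
    middle K (2 * (X 2 * X 4) - 3 * X 3) = 2 * (X 2 * X 4) - 3 * X 3 := by
  simp [middle_X, map_ofNat (middle K)]

theorem middle_X₆_coeff :
    middle K (3 * (X 1 * X 3) - 2 * X 2 ^ 3) = 3 * (X 1 * X 3) - 2 * X 2 ^ 3 := by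
  simp [middle_X, map_ofNat (middle K)]

variable [CharZero K]

theorem X₁_coeff_mul_X₁_sub_mem (α β : K) :
    (2 * (X 2 * X 4) - 3 * X 3) * X 0 - numX₁ α ∈ ideal α β := by
  convert (ideal α β).mul_mem_left 2 (Omega₁_sub_C_mem α β) using 1
  simp only [numX₁, C_mul, map_ofNat]
  linear_combination -two_mul_Omega₁ (K := K)

theorem X₆_coeff_mul_X₆_sub_mem (α β : K) :
    (3 * (X 1 * X 3) - 2 * X 2 ^ 3) * X 5 - numX₆ β ∈ ideal α β := by
  convert (ideal α β).mul_mem_left 3 (Omega₂_sub_C_mem α β) using 1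
  have h1 : (2 : MvPolynomial (Fin 6) K) * C (1 / 2) = 1 := by
    rw [← map_ofNat C 2, ← C_mul]; norm_num
  simp only [numX₆, C_mul, map_ofNat]
  linear_combination -C (1 / 2) * six_mul_Omega₂ (K := K) +
    (3 * Omega₂ K - 3 * (X 1 * X 3 * X 5) + 2 * X 2 ^ 3 * X 5) * h1

theorem X₁_coeff_ne_zero : (2 * (X 2 * X 4) - 3 * X 3 : MvPolynomial (Fin 6) K) ≠ 0 := by
  intro h
  simpa using congrArg (eval ![0, 0, 0, 1, 0, 0]) h

theorem X₆_coeff_ne_zero : (3 * (X 1 * X 3) - 2 * X 2 ^ 3 : MvPolynomial (Fin 6) K) ≠ 0 := by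
  intro h
  simpa using congrArg (eval ![0, 0, 1, 0, 0, 0]) h

theorem ideal_le_ker_genericPoint (α β : K) :
    ideal α β ≤ RingHom.ker (genericPoint α β) := by
  have hu := (map_ne_zero_iff _ (IsFractionRing.injective (MvPolynomial (Fin 6) K)
    (FractionRing (MvPolynomial (Fin 6) K)))).2 (X₁_coeff_ne_zero (K := K))
  have hw := (map_ne_zero_iff _ (IsFractionRing.injective (MvPolynomial (Fin 6) K)
    (FractionRing (MvPolynomial (Fin 6) K)))).2 (X₆_coeff_ne_zero (K := K))
  have h0 : genericPoint α β ((2 * (X 2 * X 4) - 3 * X 3) * X 0) =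
      genericPoint α β (numX₁ α) := by
    rw [map_mul, ← middle_X₁_coeff, ← middle_numX₁, genericPoint_middle, genericPoint_middle,
      middle_X₁_coeff, middle_numX₁]
    simp only [genericPoint, aeval_X]
    exact mul_div_cancel₀ _ hu
  have h5 : genericPoint α β ((3 * (X 1 * X 3) - 2 * X 2 ^ 3) * X 5) =
      genericPoint α β (numX₆ β) := by
    rw [map_mul, ← middle_X₆_coeff, ← middle_numX₆, genericPoint_middle, genericPoint_middle,
      middle_X₆_coeff, middle_numX₆]
    simp only [genericPoint, aeval_X]
    exact mul_div_cancel₀ _ hw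
  refine Ideal.span_le.2 ?_
  rintro _ (rfl | rfl)
  · refine Ideal.mem_of_natCast_mul_mem (K := K) two_ne_zero ?_
    rw [RingHom.mem_ker, ← sub_eq_zero.2 h0, ← map_sub]
    congr 1
    simp only [numX₁, C_mul, map_ofNat]
    push_cast
    linear_combination two_mul_Omega₁ (K := K)
  · refine Ideal.mem_of_natCast_mul_mem (K := K) three_ne_zero ?_
    rw [RingHom.mem_ker, ← sub_eq_zero.2 h5, ← map_sub]
    congr 1
    have h1 : (2 : MvPolynomial (Fin 6) K) * C (1 / 2) = 1 := by
      rw [← map_ofNat C 2, ← C_mul]; norm_num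
    simp only [numX₆, C_mul, map_ofNat]
    push_cast
    linear_combination C (1 / 2) * six_mul_Omega₂ (K := K) -
      (3 * Omega₂ K - 3 * (X 1 * X 3 * X 5) + 2 * X 2 ^ 3 * X 5) * h1

/-- Modulo I, uX₁ and wX₆ are polynomials in X₂, …, X₅, so a power of uw clears all occurrences of
X₁ and X₆. -/
theorem exists_pow_mul_sub_middle_mem (α β : K) (f : MvPolynomial (Fin 6) K) :
    ∃ (n : ℕ) (g : MvPolynomial (Fin 6) K),
      ((2 * (X 2 * X 4) - 3 * X 3) * (3 * (X 1 * X 3) - 2 * X 2 ^ 3)) ^ n * f - middle K g ∈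
        ideal α β := by
  set u : MvPolynomial (Fin 6) K := 2 * (X 2 * X 4) - 3 * X 3 with hu
  set w : MvPolynomial (Fin 6) K := 3 * (X 1 * X 3) - 2 * X 2 ^ 3 with hw
  have hmu : middle K u = u := middle_X₁_coeff
  have hmw : middle K w = w := middle_X₆_coeff
  have hX : ∀ i, ∃ h, u * w * X i - middle K h ∈ ideal α β := by
    have hmid : ∀ i, middle K (X i) = X i → ∃ h, u * w * X i - middle K h ∈ ideal α β := by
      intro i hi
      exact ⟨u * w * X i, by rw [map_mul, map_mul, hmu, hmw, hi, sub_self]; exact zero_mem _⟩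
    intro i
    fin_cases i
    · refine ⟨w * numX₁ α, ?_⟩
      rw [map_mul, hmw, middle_numX₁]
      convert (ideal α β).mul_mem_left w (X₁_coeff_mul_X₁_sub_mem α β) using 1
      simp only [Fin.zero_eta]; ring
    · exact hmid 1 (by simp [middle])
    · exact hmid 2 (by simp [middle])
    · exact hmid 3 (by simp [middle])
    · exact hmid 4 (by simp [middle])
    · refine ⟨u * numX₆ β, ?_⟩
      rw [map_mul, hmu, middle_numX₆]
      convert (ideal α β).mul_mem_left u (X₆_coeff_mul_X₆_sub_mem α β) using 1
      simp only [Fin.reduceFinMk]; ring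
  induction f using MvPolynomial.induction_on with
  | C a => exact ⟨0, C a, by simp [middle, algebraMap_eq]⟩
  | add f f' hf hf' =>
    obtain ⟨n, g, h⟩ := hf
    obtain ⟨n', g', h'⟩ := hf'
    refine ⟨n + n', (u * w) ^ n' * g + (u * w) ^ n * g', ?_⟩
    convert (ideal α β).add_mem ((ideal α β).mul_mem_left ((u * w) ^ n') h)
      ((ideal α β).mul_mem_left ((u * w) ^ n) h') using 1
    simp only [map_add, map_mul, map_pow, hmu, hmw]; ring
  | mul_X f i hf =>
    obtain ⟨n, g, h⟩ := hf
    obtain ⟨g', h'⟩ := hX i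
    refine ⟨n + 1, g * g', ?_⟩
    convert (ideal α β).add_mem ((ideal α β).mul_mem_left (u * w * X i) h)
      ((ideal α β).mul_mem_left (middle K g) h') using 1
    rw [map_mul]; ring

theorem mem_ideal_of_pow_mul_mem {α β : K} (hαβ : (α, β) ≠ (0, 0)) (n : ℕ)
    {f : MvPolynomial (Fin 6) K}
    (hf : ((2 * (X 2 * X 4) - 3 * X 3) * (3 * (X 1 * X 3) - 2 * X 2 ^ 3)) ^ n * f ∈ ideal α β) :
    f ∈ ideal α β := by
  induction n with
  | zero => simpa using hf
  | succ n ih =>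
    rw [pow_succ', mul_assoc, mul_assoc] at hf
    exact ih (mem_ideal_of_X₆_coeff_mul_mem hαβ (mem_ideal_of_X₁_coeff_mul_mem hαβ hf))

/-- If f dies at the generic point, so does the representative in K[X₂, …, X₅] of (uw)^n f. That
representative is therefore 0, so (uw)^n f ∈ I, and uw cancels. -/
theorem isPrime_ideal {α β : K} (hαβ : (α, β) ≠ (0, 0)) : (ideal α β).IsPrime := by
  have : ideal α β = RingHom.ker (genericPoint α β) := by
    refine le_antisymm (ideal_le_ker_genericPoint α β) fun f hf => ?_
    obtain ⟨n, g, hg⟩ := exists_pow_mul_sub_middle_mem α β f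
    have h1 := ideal_le_ker_genericPoint α β hg
    rw [RingHom.mem_ker] at hf h1
    rw [map_sub, map_mul, hf, mul_zero, zero_sub, neg_eq_zero, genericPoint_middle] at h1
    rw [(map_eq_zero_iff _ (IsFractionRing.injective _ _)).1 h1, sub_zero] at hg
    exact mem_ideal_of_pow_mul_mem hαβ n hg
  rw [this]
  exact RingHom.ker_isPrime _

end Prime

end G2

/-! ### Symplectic level sets and maximality over an algebraically closed field -/

namespace G2

section Symplectic

variable {K : Type*} [Field K] [CharZero K]

/-- Ω₁ and Ω₂ are homogeneous of degrees 4 and 6 for the weights (1, 3, 2, 3, 1, 0); eliminate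
between the two Euler relations. -/
theorem euler_jacobianMinor₁ (b : Fin 6) :
    8 * Omega₁ K * gradOmega₂ K b - 36 * Omega₂ K * gradOmega₁ K b =
      X 0 * jacobianMinor K 0 b + 3 * X 1 * jacobianMinor K 1 b + 2 * X 2 * jacobianMinor K 2 b +
        3 * X 3 * jacobianMinor K 3 b + X 4 * jacobianMinor K 4 b := by
  have h1 : 8 * Omega₁ K = X 0 * gradOmega₁ K 0 + 3 * X 1 * gradOmega₁ K 1 +
      2 * X 2 * gradOmega₁ K 2 + 3 * X 3 * gradOmega₁ K 3 + X 4 * gradOmega₁ K 4 := by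
    simp [gradOmega₁]
    linear_combination 4 * two_mul_Omega₁ (K := K)
  have h2 : 36 * Omega₂ K = X 0 * gradOmega₂ K 0 + 3 * X 1 * gradOmega₂ K 1 +
      2 * X 2 * gradOmega₂ K 2 + 3 * X 3 * gradOmega₂ K 3 + X 4 * gradOmega₂ K 4 := by
    simp [gradOmega₂]
    linear_combination 6 * six_mul_Omega₂ (K := K)
  unfold jacobianMinor
  linear_combination gradOmega₂ K b * h1 - gradOmega₁ K b * h2

/-- The same for the weights (0, 1, 1, 2, 1, 1), with degrees 2 and 4. The degree pairs (4, 6) and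
(2, 4) are independent, so vanishing of all minors at a point kills both Ω₁ dΩ₂ and Ω₂ dΩ₁ there. -/
theorem euler_jacobianMinor₂ (b : Fin 6) :
    4 * Omega₁ K * gradOmega₂ K b - 24 * Omega₂ K * gradOmega₁ K b =
      X 1 * jacobianMinor K 1 b + X 2 * jacobianMinor K 2 b + 2 * X 3 * jacobianMinor K 3 b +
        X 4 * jacobianMinor K 4 b + X 5 * jacobianMinor K 5 b := by
  have h1 : 4 * Omega₁ K = X 1 * gradOmega₁ K 1 + X 2 * gradOmega₁ K 2 +
      2 * X 3 * gradOmega₁ K 3 + X 4 * gradOmega₁ K 4 + X 5 * gradOmega₁ K 5 := by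
    simp [gradOmega₁]
    linear_combination 2 * two_mul_Omega₁ (K := K)
  have h2 : 24 * Omega₂ K = X 1 * gradOmega₂ K 1 + X 2 * gradOmega₂ K 2 +
      2 * X 3 * gradOmega₂ K 3 + X 4 * gradOmega₂ K 4 + X 5 * gradOmega₂ K 5 := by
    simp [gradOmega₂]
    linear_combination 4 * six_mul_Omega₂ (K := K)
  unfold jacobianMinor
  linear_combination gradOmega₂ K b * h1 - gradOmega₁ K b * h2

/-- `dΩ₁` and `dΩ₂` are linearly independent away from `Ω₁ = Ω₂ = 0`. -/
theorem exists_eval_jacobianMinor_ne_zero (p : Fin 6 → K)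
    (hp : (eval p (Omega₁ K), eval p (Omega₂ K)) ≠ (0, 0)) :
    ∃ a b, eval p (jacobianMinor K a b) ≠ 0 := by
  by_contra! h
  have e1 := fun b => congrArg (eval p) (euler_jacobianMinor₁ (K := K) b)
  have e2 := fun b => congrArg (eval p) (euler_jacobianMinor₂ (K := K) b)
  have w1 := congrArg (eval p) (two_mul_Omega₁ (K := K))
  have w2 := congrArg (eval p) (six_mul_Omega₂ (K := K))
  simp only [map_sub, map_add, map_mul, map_pow, map_ofNat, h, mul_zero, add_zero, eval_X]
    at e1 e2 w1 w2
  generalize eval p (Omega₁ K) = α at *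
  generalize eval p (Omega₂ K) = β at *
  by_cases hβ : β = 0
  · by_cases hα : α = 0
    · exact hp (by rw [hα, hβ])
    · have hg : ∀ b, eval p (gradOmega₂ K b) = 0 := by
        intro b
        have h1 : α * eval p (gradOmega₂ K b) = 0 := by
          linear_combination (1 / 4) * e2 b + 6 * eval p (gradOmega₁ K b) * hβ
        exact (mul_eq_zero.1 h1).resolve_left hα
      -- The last partial derivative of Ω₂ is a multiple of w; together with Ω₂(p) = 0 it gives u(p)
      -- = v(p) = 0, hence Ω₁(p) = 0.
      have hw : 3 * (p 1 * p 3) = 2 * p 2 ^ 3 := by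
        have := hg 5
        simp [gradOmega₂] at this
        linear_combination (1 / 2) * this
      obtain ⟨hv, hu⟩ := discriminant_locus K hw (x₅ := p 4) (by
        linear_combination 6 * hβ - w2 - 2 * p 5 * hw)
      refine hα ?_
      linear_combination (1 / 2) * (w1 + p 0 * hu - hv)
  · have hg : ∀ b, eval p (gradOmega₁ K b) = 0 := by
      intro b
      have h1 : β * eval p (gradOmega₁ K b) = 0 := by
        linear_combination (1 / 12) * e1 b - (1 / 6) * e2 b
      exact (mul_eq_zero.1 h1).resolve_left hβ
    -- A critical point of Ω₁ has X₃ = X₄ = X₅ = 0, where Ω₂ vanishes.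
    have h0 := hg 0
    have h1 := hg 1
    have h2 := hg 2
    simp [gradOmega₁] at h0 h1 h2
    simp only [h1, mul_zero, zero_sub, neg_eq_zero, zero_add, mul_eq_zero, OfNat.ofNat_ne_zero,
      false_or] at h0 h2
    refine hβ ?_
    rw [h0, h1, h2] at w2
    linear_combination (1 / 6) * w2

/-- Modulo m², the Euler field sends Ω₁ to Ω₁ − α, which lies in the ideal: dΩ₁ vanishes on
directions tangent to the level set. -/
theorem sum_mul_gradOmega₁_mem (p : Fin 6 → K) {α β : K}
    (hp : ideal α β ≤ RingHom.ker (eval p)) :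
    ∑ i, (X i - C (p i)) * gradOmega₁ K i ∈ RingHom.ker (eval p) ^ 2 ⊔ ideal α β := by
  have h1 := RingHom.mem_ker.1 (hp (Omega₁_sub_C_mem α β))
  rw [map_sub, eval_C, sub_eq_zero] at h1
  have h2 := Submodule.add_mem_sup (eulerAt_sub_mem_ker_eval_sq p (Omega₁ K))
    (Omega₁_sub_C_mem α β)
  rw [h1, sub_add_cancel] at h2
  convert Ideal.mul_mem_left _ 2 h2 using 1
  simp only [eulerAt, Finset.mul_sum, ← two_mul_pderiv_Omega₁]
  exact Finset.sum_congr rfl fun i _ => by ring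

theorem sum_mul_gradOmega₂_mem (p : Fin 6 → K) {α β : K}
    (hp : ideal α β ≤ RingHom.ker (eval p)) :
    ∑ i, (X i - C (p i)) * gradOmega₂ K i ∈ RingHom.ker (eval p) ^ 2 ⊔ ideal α β := by
  have h1 := RingHom.mem_ker.1 (hp (Omega₂_sub_C_mem α β))
  rw [map_sub, eval_C, sub_eq_zero] at h1
  have h2 := Submodule.add_mem_sup (eulerAt_sub_mem_ker_eval_sq p (Omega₂ K))
    (Omega₂_sub_C_mem α β)
  rw [h1, sub_add_cancel] at h2
  convert Ideal.mul_mem_left _ 6 h2 using 1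
  simp only [eulerAt, Finset.mul_sum, ← six_mul_pderiv_Omega₂]
  exact Finset.sum_congr rfl fun i _ => by ring

theorem _root_.Ideal.mul_mem_pow_sup {A : Type*} [CommRing A] {M I : Ideal A} {k n : ℕ} {x y : A}
    (hx : x ∈ M ^ k ⊔ I) (hy : y ∈ M ^ n ⊔ I) : x * y ∈ M ^ (k + n) ⊔ I := by
  obtain ⟨x₁, hx₁, x₂, hx₂, rfl⟩ := Submodule.mem_sup.1 hx
  obtain ⟨y₁, hy₁, y₂, hy₂, rfl⟩ := Submodule.mem_sup.1 hy
  have h := Submodule.add_mem_sup (pow_add M k n ▸ Ideal.mul_mem_mul hx₁ hy₁)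
    (I.add_mem (I.mul_mem_left x₁ hy₂) (I.mul_mem_right (y₁ + y₂) hx₂))
  convert h using 1
  ring

/-- If `f` vanishes to order `n + 1` at `p` on the level set and so do all its brackets with the
generators, then `f` vanishes to order `n + 2`. -/
theorem mem_pow_succ_sup_of_bracket_mem (p : Fin 6 → K) {α β : K}
    (hp : ideal α β ≤ RingHom.ker (eval p)) {a b : Fin 6}
    (hab : eval p (jacobianMinor K a b) ≠ 0) {n : ℕ} {f : MvPolynomial (Fin 6) K}
    (hf : f ∈ RingHom.ker (eval p) ^ (n + 1))
    (h : ∀ l, bracketMap K (X l) f ∈ RingHom.ker (eval p) ^ (n + 1) ⊔ ideal α β) :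
    f ∈ RingHom.ker (eval p) ^ (n + 2) ⊔ ideal α β := by
  set m := RingHom.ker (eval p) with hm
  set I := ideal α β
  simp only [bracket_X_left] at h
  have h1 : ∀ i, (X i - C (p i)) * (jacobianMinor K a b * pderiv i f +
      jacobianMinor K b i * pderiv a f + jacobianMinor K i a * pderiv b f) ∈
      m ^ (1 + (n + 1)) ⊔ I := by
    intro i
    refine Ideal.mul_mem_pow_sup (Ideal.mem_sup_left ?_)
      (jacobianMinor_cyclic_mem (v := fun i => pderiv i f) h i a b)
    rw [pow_one]
    exact X_sub_C_mem_ker_eval p i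
  have h2 := Ideal.sum_mem (t := Finset.univ) _ fun i _ => h1 i
  have hd : ∀ i, pderiv i f ∈ m ^ n ⊔ I := fun i =>
    Ideal.mem_sup_left (Derivation.apply_mem_pow _ _ _ hf)
  have hS1 := sum_mul_gradOmega₁_mem p hp
  have hS2 := sum_mul_gradOmega₂_mem p hp
  -- In the sum over i of `h1`, the terms in ∂f/∂X_a and ∂f/∂X_b carry Σ (X_i − p_i)
  -- dΩ_i-components, of order two on the level set; only the Euler field of f is left.
  have h3 : jacobianMinor K a b * eulerAt p f ∈ m ^ (2 + n) ⊔ I := by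
    have e1 := Ideal.mul_mem_pow_sup hS1 (hd a)
    have e2 := Ideal.mul_mem_pow_sup hS2 (hd a)
    have e3 := Ideal.mul_mem_pow_sup hS1 (hd b)
    have e4 := Ideal.mul_mem_pow_sup hS2 (hd b)
    have e5 : 1 + (n + 1) = 2 + n := by ring
    rw [e5] at h2
    have e6 := Ideal.add_mem _ (Ideal.add_mem _ h2 (Ideal.sub_mem _
      (Ideal.mul_mem_left _ (gradOmega₂ K b) e1) (Ideal.mul_mem_left _ (gradOmega₁ K b) e2)))
      (Ideal.sub_mem _ (Ideal.mul_mem_left _ (gradOmega₁ K a) e4)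
        (Ideal.mul_mem_left _ (gradOmega₂ K a) e3))
    convert e6 using 1
    simp only [jacobianMinor, eulerAt, Finset.mul_sum, Finset.sum_mul, ← Finset.sum_sub_distrib,
      ← Finset.sum_add_distrib]
    exact Finset.sum_congr rfl fun i _ => by ring
  rw [add_comm 2 n] at h3
  -- To leading order the Euler field multiplies f by n + 1, and the minor may be replaced by its
  -- nonzero value at p.
  have h4 := eulerAt_sub_mem_ker_eval_pow p (n + 1) hf
  have h5 := Ideal.mul_mem_mul hf (sub_C_eval_mem_ker_eval p (jacobianMinor K a b))
  rw [← pow_succ] at h5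
  have h6 := Ideal.sub_mem _ (Ideal.sub_mem _ h3 (Ideal.mem_sup_left
    (Ideal.mul_mem_left _ (jacobianMinor K a b) h4)))
    (Ideal.mem_sup_left (Ideal.mul_mem_left _ ((n + 1 : ℕ) : MvPolynomial (Fin 6) K) h5))
  refine Ideal.mem_of_natCast_mul_mem (K := K) n.succ_ne_zero ?_
  have h7 : C (eval p (jacobianMinor K a b))⁻¹ * C (eval p (jacobianMinor K a b)) =
      (1 : MvPolynomial (Fin 6) K) := by
    rw [← C_mul, inv_mul_cancel₀ hab, C_1]
  convert Ideal.mul_mem_left _ (C (eval p (jacobianMinor K a b))⁻¹) h6 using 1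
  simp only [Nat.succ_eq_add_one]
  linear_combination (-((n + 1 : ℕ) : MvPolynomial (Fin 6) K) * f) * h7

/-- Krull's intersection theorem modulo a prime ideal. -/
theorem _root_.Ideal.IsPrime.mem_of_forall_mem_pow_sup {A : Type*} [CommRing A]
    [IsNoetherianRing A] {I M : Ideal A} (hI : I.IsPrime) (hIM : I ≤ M) (hM : M ≠ ⊤) {f : A}
    (hf : ∀ n : ℕ, f ∈ M ^ n ⊔ I) : f ∈ I := by
  have hM' : M.map (Ideal.Quotient.mk I) ≠ ⊤ := by
    intro h
    refine hM ?_
    rw [← Ideal.comap_map_mk hIM, h, Ideal.comap_top]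
  have h1 : Ideal.Quotient.mk I f ∈ ⨅ n : ℕ, M.map (Ideal.Quotient.mk I) ^ n := by
    refine Submodule.mem_iInf _ |>.2 fun n => ?_
    rw [← Ideal.map_pow]
    have := Ideal.mem_map_of_mem (Ideal.Quotient.mk I) (hf n)
    rwa [Ideal.map_sup, Ideal.map_quotient_self, sup_bot_eq] at this
  rw [Ideal.iInf_pow_eq_bot_of_isDomain _ hM'] at h1
  exact Ideal.Quotient.eq_zero_iff_mem.1 h1

theorem eq_ideal_of_isPoissonIdeal_of_isAlgClosed [IsAlgClosed K] {α β : K}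
    (hαβ : (α, β) ≠ (0, 0)) {J : Ideal (MvPolynomial (Fin 6) K)} (hJ : (poisson K).IsPoissonIdeal J)
    (hle : ideal α β ≤ J) (hne : J ≠ ⊤) : J = ideal α β := by
  obtain ⟨M, hM, hJM⟩ := J.exists_le_maximal hne
  obtain ⟨p, rfl⟩ := isMaximal_iff_eq_vanishingIdeal_singleton.1 hM
  have hJp : J ≤ RingHom.ker (eval p) := fun f hf => by
    have := (mem_vanishingIdeal_singleton_iff p f).1 (hJM hf)
    rwa [RingHom.mem_ker, ← coe_aeval_eq_eval]
  have hp := hle.trans hJp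
  have h1 := RingHom.mem_ker.1 (hp (Omega₁_sub_C_mem α β))
  have h2 := RingHom.mem_ker.1 (hp (Omega₂_sub_C_mem α β))
  rw [map_sub, eval_C, sub_eq_zero] at h1 h2
  obtain ⟨a, b, hab⟩ := exists_eval_jacobianMinor_ne_zero p (by rwa [h1, h2])
  have key : ∀ n : ℕ, J ≤ RingHom.ker (eval p) ^ (n + 1) ⊔ ideal α β := by
    intro n
    induction n with
    | zero => rw [zero_add, pow_one]; exact hJp.trans le_sup_left
    | succ n ih =>
      intro f hf
      obtain ⟨g, hg, i, hi, rfl⟩ := Submodule.mem_sup.1 (ih hf)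
      -- Since I ⊆ J, the correction i can be dropped without leaving J, so the brackets of g still
      -- lie in J and the induction hypothesis applies to them.
      have hgJ : g ∈ J := by
        have := J.sub_mem hf (hle hi)
        rwa [add_sub_cancel_right] at this
      exact Ideal.add_mem _ (mem_pow_succ_sup_of_bracket_mem p hp hab hg
        fun l => ih (hJ (X l) g hgJ)) (Ideal.mem_sup_right hi)
  refine le_antisymm (fun f hf => ?_) hle
  refine (isPrime_ideal hαβ).mem_of_forall_mem_pow_sup hp (RingHom.ker_ne_top _) fun n => ?_
  have hmono : RingHom.ker (eval p) ^ (n + 1) ⊔ ideal α β ≤ RingHom.ker (eval p) ^ n ⊔ ideal α β :=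
    sup_le_sup (Ideal.pow_le_pow_right n.le_succ) le_rfl
  exact hmono (key n hf)

end Symplectic

/-! ### Descent from the algebraic closure -/

section BaseChange

variable {K L : Type*} [Field K] [Field L] [Algebra K L]

theorem map_gen (i j : Fin 6) : map (algebraMap K L) (gen K i j) = gen L i j := by
  fin_cases i <;> fin_cases j <;> simp [gen, lower]

theorem map_bracketMap (f g : MvPolynomial (Fin 6) K) :
    map (algebraMap K L) (bracketMap K f g) =
      bracketMap L (map (algebraMap K L) f) (map (algebraMap K L) g) := by
  simp only [bracketMap_apply, map_sum, map_mul, map_gen, pderiv_map]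

/-- An additive map from `L[X]` to `K[X]` which is linear over `K[X]` and splits the inclusion. -/
theorem exists_retraction (K L σ : Type*) [Field K] [Field L] [Algebra K L] :
    ∃ r : MvPolynomial σ L →+ MvPolynomial σ K,
      (∀ (a : MvPolynomial σ L) (g : MvPolynomial σ K),
        r (a * map (algebraMap K L) g) = r a * g) ∧ r 1 = 1 := by
  -- A K-linear retraction of L onto K, applied to each coefficient.
  obtain ⟨s, hs⟩ := (Algebra.linearMap K L).exists_leftInverse_of_injective
    (LinearMap.ker_eq_bot.2 (algebraMap K L).injective)
  have hs1 : s 1 = 1 := by simpa using LinearMap.congr_fun hs 1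
  have hr : ∀ a : MvPolynomial σ L, ∃ b : MvPolynomial σ K, ∀ n, coeff n b = s (coeff n a) := by
    intro a
    induction a using MvPolynomial.induction_on' with
    | monomial u c =>
      refine ⟨monomial u (s c), fun n => ?_⟩
      classical
      simp only [coeff_monomial]
      split_ifs <;> simp
    | add p q hp hq =>
      obtain ⟨b, hb⟩ := hp
      obtain ⟨b', hb'⟩ := hq
      exact ⟨b + b', fun n => by rw [coeff_add, coeff_add, map_add, hb, hb']⟩
  choose r hr using hr
  refine ⟨AddMonoidHom.mk' r fun a b => ?_, fun a g => ?_, ?_⟩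
  · ext n; simp [hr]
  · classical
    ext n
    simp only [AddMonoidHom.mk'_apply, hr, coeff_mul, map_sum, coeff_map]
    refine Finset.sum_congr rfl fun x _ => ?_
    rw [mul_comm, ← Algebra.smul_def, map_smul, smul_eq_mul, mul_comm]
  · classical
    ext n
    simp only [AddMonoidHom.mk'_apply, hr, coeff_one]
    split_ifs <;> simp [hs1]

theorem mem_of_map_mem_map {σ : Type*} {J : Ideal (MvPolynomial σ K)} {f : MvPolynomial σ K}
    (hf : map (algebraMap K L) f ∈ J.map (map (algebraMap K L))) : f ∈ J := by
  obtain ⟨r, hr, hr1⟩ := exists_retraction K L σ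
  -- The multiplier c is needed because r is linear only over K[X], while the span is closed under
  -- L[X].
  have key : ∀ a ∈ J.map (map (algebraMap K L)), ∀ c, r (c * a) ∈ J := by
    intro a ha
    induction ha using Submodule.span_induction with
    | mem a ha =>
      obtain ⟨g, hg, rfl⟩ := ha
      intro c
      rw [hr]
      exact J.mul_mem_left _ hg
    | zero => simp
    | add a b _ _ ha hb =>
      intro c
      rw [mul_add, map_add]
      exact J.add_mem (ha c) (hb c)
    | smul c' a _ ha =>
      intro c
      rw [smul_eq_mul, ← mul_assoc]
      exact ha _
  have := key _ hf 1
  rwa [hr, hr1, one_mul] at this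

theorem map_ideal (α β : K) : (ideal α β).map (map (algebraMap K L)) =
    ideal (algebraMap K L α) (algebraMap K L β) := by
  rw [ideal, ideal, Ideal.map_span, Set.image_pair]
  simp [Omega₁, Omega₂, map_ofNat (algebraMap K L)]

/-- The bracket is a biderivation whose values on the generators are defined over K, so it suffices
to bracket each X_i with elements of J. -/
theorem isPoissonIdeal_map {J : Ideal (MvPolynomial (Fin 6) K)}
    (hJ : (poisson K).IsPoissonIdeal J) :
    (poisson L).IsPoissonIdeal (J.map (map (algebraMap K L))) := by
  have hX : ∀ i, ∀ y ∈ J.map (map (algebraMap K L)),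
      bracketMap L (X i) y ∈ J.map (map (algebraMap K L)) := by
    intro i y hy
    induction hy using Submodule.span_induction with
    | mem y hy =>
      obtain ⟨g, hg, rfl⟩ := hy
      rw [← map_X (algebraMap K L), ← map_bracketMap]
      exact Ideal.mem_map_of_mem _ (hJ _ _ hg)
    | zero => simp
    | add a b _ _ ha hb => rw [map_add]; exact Ideal.add_mem _ ha hb
    | smul c a ha h =>
      rw [smul_eq_mul, bracketMap_leibniz]
      exact Ideal.add_mem _ (Ideal.mul_mem_left _ _ ha) (Ideal.mul_mem_left _ _ h)
  intro x y hy
  change bracketMap L x y ∈ _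
  have : bracketMap L x y = ∑ i, pderiv i x * bracketMap L (X i) y := by
    simp only [bracket_X_left]
    simp only [bracketMap_apply, Finset.mul_sum]
    exact Finset.sum_congr rfl fun i _ => Finset.sum_congr rfl fun j _ => by ring
  rw [this]
  exact Ideal.sum_mem _ fun i _ => Ideal.mul_mem_left _ _ (hX i y hy)

end BaseChange

/-- `⟨Ω₁ - α, Ω₂ - β⟩` is a maximal Poisson ideal for `(α, β) ≠ (0, 0)`. -/
theorem isMaximalPoissonIdeal_ideal {K : Type*} [Field K] [CharZero K] {α β : K}
    (hαβ : (α, β) ≠ (0, 0)) : (poisson K).IsMaximalPoissonIdeal (ideal α β) := by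
  refine ⟨isPoissonIdeal_ideal α β, (isPrime_ideal hαβ).ne_top, fun J hJ hle hne => ?_⟩
  let L := AlgebraicClosure K
  have : CharZero L := charZero_of_injective_algebraMap (algebraMap K L).injective
  have hαβ' : (algebraMap K L α, algebraMap K L β) ≠ (0, 0) := by
    simpa [Prod.ext_iff] using hαβ
  have h1 : ideal (algebraMap K L α) (algebraMap K L β) ≤ J.map (map (algebraMap K L)) := by
    rw [← map_ideal]
    exact Ideal.map_mono hle
  have h2 : J.map (map (algebraMap K L)) ≠ ⊤ := by
    intro h
    refine hne (J.eq_top_iff_one.2 (mem_of_map_mem_map (L := L) ?_))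
    rw [h]
    exact Submodule.mem_top
  have h3 := eq_ideal_of_isPoissonIdeal_of_isAlgClosed hαβ' (isPoissonIdeal_map hJ) h1 h2
  refine le_antisymm (fun f hf => mem_of_map_mem_map (L := L) ?_) hle
  rw [map_ideal, ← h3]
  exact Ideal.mem_map_of_mem _ hf

end G2

theorem mainTheorem3 {K : Type*} [Field K] [CharZero K] (α β : K) (hαβ : (α, β) ≠ (0, 0)) :
    (G2.poisson K).IsPoissonPrime (G2.ideal α β) ∧
      (G2.poisson K).IsMaximalPoissonIdeal (G2.ideal α β) ∧
      (G2.quotientPoisson α β).IsPoissonSimple ∧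
      IsNoetherianRing (G2.QuotientAlgebra α β) ∧
      IsDomain (G2.QuotientAlgebra α β) := by
  have hprime := G2.isPrime_ideal hαβ
  have hmax := G2.isMaximalPoissonIdeal_ideal hαβ
  exact ⟨(G2.isPoissonIdeal_ideal α β).isPoissonPrime hprime, hmax,
    hmax.isPoissonSimple_quotient _, inferInstance, inferInstance⟩
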